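/- Let $\mathbb G$ be a Carnot group: a connected, simply connected Lie group whose Lie algebra has a stratification $\mathfrak g=V_1\oplus\cdots\oplus V_s$, $[V_1,V_i]=V_{i+1}$, $V_s\neq 0$, $V_k=0$ for $k>s$. Fix a basis $X_1,\dots,X_n$ of $\mathfrak g$ adapted to the stratification, with dual basis $\theta_1,\dots,\theta_n$, and the metric for which it is orthonormal. Let $w(\theta_j)=i$ if $X_j\in V_i$, let $\theta_{j_1}\wedge\cdots\wedge\theta_{j_h}$ have weight $w(\theta_{j_1})+\cdots+w(\theta_{j_h})$, and let $Q=\sum_j w(\theta_j)$. Let $\Omega^*$ be the smooth forms on $\mathbb G$, $\Omega^{p,*}$ those of pure weight $p$ (combinations, with smooth coefficients, of left-invariant forms of weight $p$), $(\alpha)_p$ the component of weight $p$ of $\alpha$, $F_p=\bigoplus_{a\ge p}\Omega^{a,*}$, and let $d_i$ be the part of the de Rham differential $d$ that raises the weight by $i$. Let $d_0^{-1}$ be the operator, acting pointwise, that sends a covector $\beta$ to the unique $\alpha\perp\ker d_0$ with $d_0\alpha-\beta\perp \operatorname{im}d_0$. Put $E_0=\ker d_0\cap(\operatorname{im}d_0)^\perp$,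 $E_0^h=E_0\cap\Omega^h$, $\Pi_{E_0}=\mathrm{Id}-d_0d_0^{-1}-d_0^{-1}d_0$, $P=\sum_{k=0}^{Q}(-1)^k[d_0^{-1}(d-d_0)]^k$, $\Pi_E=\mathrm{Id}-dPd_0^{-1}-Pd_0^{-1}d$, $d_c=\Pi_{E_0}d\,\Pi_E$, and $$\zeta_j=\sum_{m=1}^{j}(-1)^{m-1}\sum_{\substack{i_1,\dots,i_m\ge1\\ i_1+\cdots+i_m=j}}(d_0^{-1}d_{i_1})\cdots(d_0^{-1}d_{i_m}),\qquad D_r=d_r-\sum_{i=1}^{r-1}d_i\,\zeta_{r-i}.$$ For $r\ge1$ and $p\in\mathbb Z$ let $Z_r^{p,*}$ be the space of $x\in\Omega^{p,*}$ with $d_0x=0$ for which there are $z_{p+j}\in\Omega^{p+j,*}$, $1\le j\le r-1$, with $$(\star)\qquad d_mx=\sum_{i=0}^{m-1}d_iz_{p+m-i}\quad(1\le m\le r-1),$$ and let $B_r^{p,*}$ be the space of sums $\sum_{k=0}^{r-1}d_kc_{p-k}$ with $c_{p-k}\in\Omega^{p-k,*}$ and $\sum_{k=l}^{r-1}d_{k-l}c_{p-k}=0$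 for $1\le l\le r-1$. Let $E_r^{p,*}=\mathcal Z_r^{p}/\mathcal B_r^{p}$, with $\mathcal Z_r^p=F_p\cap d^{-1}F_{p+r}$, $\mathcal B_r^p=\mathcal Z_{r-1}^{p+1}+d\mathcal Z_{r-1}^{p-r+1}$ and differential $[x]\mapsto[dx]$, be the $r$-th page of the spectral sequence of the filtration $F$. Then: 1. $[d_0^{-1}(d-d_0)]^{Q+1}=0$, $\Pi_{E_0}$ takes values in $E_0$, and $d_c$ maps $E_0^h$ to $E_0^{h+1}$ for every $h$. 2. On $E_0$ one has $d_c=\Pi_{E_0}\sum_{r=1}^{N}D_r$ for every $N\ge Q$, and for $r\ge 1$ and $\alpha\in E_0\cap\Omega^{p,*}$ the component of weight $p+r$ of $d_c\alpha$ is $\Pi_{E_0}D_r\alpha$. 3. For every $r\ge1$ and all $p$, $[x]\mapsto[(x)_p]$ is a well-defined isomorphism $E_r^{p,*}\to Z_r^{p,*}/B_r^{p,*}$. Let $\partial_r:Z_r^{p,*}/B_r^{p,*}\to Z_r^{p+r,*}/B_r^{p+r,*}$ be the differential of the $r$-th page read through these isomorphisms. If $x\in\Omega^{p,*}$, $d_0x=0$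 and the $z_{p+j}$ satisfy $(\star)$, then $\partial_r[x]=[d_rx-\sum_{i=1}^{r-1}d_iz_{p+r-i}]$. If moreover all $z_{p+j}\perp\ker d_0$, then $z_{p+j}=\zeta_jx$ for $1\le j\le r-1$, and $$\partial_r[x]=[D_rx].$$ This applies, with $z_{p+j}=\zeta_j\alpha$, to every $\alpha\in E_0\cap\Omega^{p,*}$ with $d_c\alpha\in F_{p+r}$. 4. For every $r\ge 1$ and all $p$, the whole of $\partial_r$ is induced by $d_c$: if $y\in E_0\cap F_p$ and $d_cy\in F_{p+r}$, then $(y)_p\in Z_r^{p,*}$, $(d_cy)_{p+r}\in Z_r^{p+r,*}$ and $\partial_r[(y)_p]=[(d_cy)_{p+r}]$; and every class in $Z_r^{p,*}/B_r^{p,*}$ is $[(y)_p]$ for such a $y$. Thus the operators $D_r$ whose sum over $r\ge1$ gives $d_c$ on the subspace $E_0$ (up to $\Pi_{E_0}$) are those that give the differentials $\partial_r$ on the quotients $Z_r/B_r\cong E_r$. -/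

import Mathlib

open scoped Manifold ContDiff Topology

noncomputable section
namespace Carnot

section Geometry
variable {E : Type*} [NormedAddCommGroup E] [NormedSpace ℝ E]
  {G : Type*} [TopologicalSpace G] [ChartedSpace E G] [Group G]

/-- `h`-covectors on the model space `E`. The Lie algebra of a Lie group modelled on `E` is its
tangent space at the identity, which is (a synonym of) `E`, so `Covec E h` is `Λ^h 𝔤*`. -/
abbrev Covec (E : Type*) [NormedAddCommGroup E] [NormedSpace ℝ E] (h : ℕ) : Type _ :=
  E [⋀^Fin h]→L[ℝ] ℝ

instance instChartedSpaceCovec (h : ℕ) : ChartedSpace (Covec E h) (Covec E h) :=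
  chartedSpaceSelf _

/-- Smooth differential `h`-forms on a Lie group, written in the left-invariant trivialisation
`Γ(Λ^h T*G) = C^∞(G, Λ^h 𝔤*)`: the value at `x` of the form given by `α` is the covector
`α x ∘ (dL_x)⁻¹` on `T_x G`. Left-invariant forms are the constant functions. -/
abbrev Form (E : Type*) [NormedAddCommGroup E] [NormedSpace ℝ E]
    (G : Type*) [TopologicalSpace G] [ChartedSpace E G] (h : ℕ) : Type _ :=
  ContMDiffMap 𝓘(ℝ, E) 𝓘(ℝ, Covec E h) G (Covec E h) ∞

/-- The differential at `1` of `k ↦ x * k` read in the chart at `x₀`. It sends `v ∈ 𝔤` to the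
coordinate vector at `x` of the left-invariant vector field generated by `v`. -/
def leftFrame (x₀ x : G) : E →L[ℝ] E :=
  mfderiv 𝓘(ℝ, E) 𝓘(ℝ, E) (fun k : G => extChartAt 𝓘(ℝ, E) x₀ (x * k)) 1

/-- The coordinate expression, in the chart at `x₀`, of the differential form given by `α`:
the pullback of `x ↦ α x ∘ (dL_x)⁻¹` under the inverse chart. -/
def chartForm {h : ℕ} (α : G → Covec E h) (x₀ : G) (y : E) : Covec E h :=
  (α ((extChartAt 𝓘(ℝ, E) x₀).symm y)).compContinuousLinearMap
    (leftFrame x₀ ((extChartAt 𝓘(ℝ, E) x₀).symm y)).inverse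

/-- The exterior derivative: in the chart at `x` it is the exterior derivative `extDeriv` of the
coordinate expression, carried back to the left-invariant trivialisation. It may be computed in any
other chart, see `dFun_eq`. -/
def dFun {h : ℕ} (α : G → Covec E h) (x : G) : Covec E (h + 1) :=
  (extDeriv (chartForm α x) (extChartAt 𝓘(ℝ, E) x x)).compContinuousLinearMap (leftFrame x x)

/-- Evaluation of a covector on all tuples of vectors of a basis. -/
def evalBasis {ι : Type*} (b : Module.Basis ι ℝ E) (h : ℕ) :
    Covec E h →ₗ[ℝ] ((Fin h → ι) → ℝ) where
  toFun ξ J := ξ (fun i => b (J i))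
  map_add' _ _ := rfl
  map_smul' _ _ := rfl

theorem evalBasis_injective {ι : Type*} [Finite ι] (b : Module.Basis ι ℝ E) (h : ℕ) :
    Function.Injective (evalBasis b h) := by
  intro ξ η he
  have hm : ξ.toMultilinearMap = η.toMultilinearMap :=
    Module.Basis.ext_multilinear (fun _ => b) (fun J => congrFun he J)
  ext v
  exact congrArg (fun m => m v) hm

instance instFiniteCovec [FiniteDimensional ℝ E] (h : ℕ) : FiniteDimensional ℝ (Covec E h) :=
  Module.Finite.of_injective _ (evalBasis_injective (Module.finBasis ℝ E) h)

theorem contDiffAt_comp_covec [FiniteDimensional ℝ E] {D : Type*} [NormedAddCommGroup D]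
    [NormedSpace ℝ D] {h : ℕ} {f : D → Covec E h} {g : D → E →L[ℝ] E} {y : D}
    (hf : ContDiffAt ℝ ∞ f y) (hg : ContDiffAt ℝ ∞ g y) :
    ContDiffAt ℝ ∞ (fun y => (f y).compContinuousLinearMap (g y)) y := by
  let b := Module.finBasis ℝ E
  obtain ⟨L, hL⟩ := LinearMap.exists_leftInverse_of_injective (evalBasis b h)
    (LinearMap.ker_eq_bot.2 (evalBasis_injective b h))
  have key : ContDiffAt ℝ ∞ (fun y => evalBasis b h ((f y).compContinuousLinearMap (g y))) y := by
    rw [contDiffAt_pi]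
    intro J
    have h1 : ContDiffAt ℝ ∞ (fun y =>
        ContinuousMultilinearMap.compContinuousLinearMapContinuousMultilinear ℝ
          (fun _ : Fin h => E) (fun _ => E) ℝ (fun _ => g y)
          (ContinuousAlternatingMap.toContinuousMultilinearMapCLM ℝ (f y))) y := by
      refine ContDiffAt.clm_apply ?_ ?_
      · exact (ContinuousMultilinearMap.contDiff _).contDiffAt.comp y
          (contDiffAt_pi.2 fun _ => hg)
      · exact (ContinuousLinearMap.contDiff _).contDiffAt.comp y hf
    exact (ContinuousMultilinearMap.apply ℝ (fun _ : Fin h => E) ℝ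
      (fun i => b (J i))).contDiff.contDiffAt.comp y h1
  have : (fun y => (f y).compContinuousLinearMap (g y)) = fun y => LinearMap.toContinuousLinearMap L
      (evalBasis b h ((f y).compContinuousLinearMap (g y))) := by
    funext y
    exact (LinearMap.congr_fun hL _).symm
  rw [this]
  exact (ContinuousLinearMap.contDiff _).contDiffAt.comp y key

theorem contDiffAt_extDeriv {h : ℕ} {η : E → Covec E h} {y : E} (hη : ContDiffAt ℝ ∞ η y) :
    ContDiffAt ℝ ∞ (extDeriv η) y := by
  have : extDeriv η = fun y =>
      ContinuousAlternatingMap.alternatizeUncurryFinCLM ℝ E ℝ (fderiv ℝ η y) := rfl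
  rw [this]
  exact (ContinuousLinearMap.contDiff _).contDiffAt.comp y (hη.fderiv_right (by simp))

variable [LieGroup 𝓘(ℝ, E) ∞ G]

theorem mdiffAt_chart_mul (x₀ x k : G) (hx : x * k ∈ (extChartAt 𝓘(ℝ, E) x₀).source) :
    MDifferentiableAt 𝓘(ℝ, E) 𝓘(ℝ, E) (fun k : G => extChartAt 𝓘(ℝ, E) x₀ (x * k)) k := by
  have h1 : MDifferentiableAt 𝓘(ℝ, E) 𝓘(ℝ, E) (extChartAt 𝓘(ℝ, E) x₀) (x * k) :=
    (contMDiffAt_extChartAt' (n := ∞) (by simpa using hx)).mdifferentiableAt (by simp)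
  have h2 : MDifferentiableAt 𝓘(ℝ, E) 𝓘(ℝ, E) (fun k : G => x * k) k :=
    (contMDiff_mul_left (I := 𝓘(ℝ, E)) (n := ∞) (a := x)).contMDiffAt.mdifferentiableAt (by simp)
  exact h1.comp k h2

theorem contDiffAt_transition (x₀ x₁ : G) {y : E} (hy : y ∈ (extChartAt 𝓘(ℝ, E) x₀).target)
    (h1 : (extChartAt 𝓘(ℝ, E) x₀).symm y ∈ (extChartAt 𝓘(ℝ, E) x₁).source) :
    ContDiffAt ℝ ∞ (extChartAt 𝓘(ℝ, E) x₁ ∘ (extChartAt 𝓘(ℝ, E) x₀).symm) y := by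
  have := contDiffWithinAt_ext_coord_change (I := 𝓘(ℝ, E)) (n := ∞) x₁ x₀ (y := y)
    (by rw [PartialEquiv.trans_source]; exact ⟨hy, h1⟩)
  rwa [modelWithCornersSelf_coe, Set.range_id, contDiffWithinAt_univ] at this

theorem leftFrame_trans (x₀ x₁ x : G) (h0 : x ∈ (extChartAt 𝓘(ℝ, E) x₀).source)
    (h1 : x ∈ (extChartAt 𝓘(ℝ, E) x₁).source) :
    leftFrame (E := E) x₁ x = (fderiv ℝ (extChartAt 𝓘(ℝ, E) x₁ ∘ (extChartAt 𝓘(ℝ, E) x₀).symm)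
      (extChartAt 𝓘(ℝ, E) x₀ x)).comp (leftFrame x₀ x) := by
  have hf := mdiffAt_chart_mul (E := E) x₀ x 1 (by simpa using h0)
  have hτ := (contDiffAt_transition (E := E) x₀ x₁ ((extChartAt 𝓘(ℝ, E) x₀).map_source h0)
    (by rwa [(extChartAt 𝓘(ℝ, E) x₀).left_inv h0])).differentiableAt (by simp)
  have hev : (fun k : G => extChartAt 𝓘(ℝ, E) x₁ (x * k)) =ᶠ[𝓝 1]
      ((extChartAt 𝓘(ℝ, E) x₁ ∘ (extChartAt 𝓘(ℝ, E) x₀).symm) ∘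
        fun k : G => extChartAt 𝓘(ℝ, E) x₀ (x * k)) := by
    have hc : ContinuousAt (fun k : G => x * k) 1 :=
      (contMDiff_mul_left (I := 𝓘(ℝ, E)) (n := ∞) (a := x)).continuous.continuousAt
    have : (extChartAt 𝓘(ℝ, E) x₀).source ∈ 𝓝 (x * 1) := by
      rw [mul_one]; exact extChartAt_source_mem_nhds' h0
    filter_upwards [hc this] with k hk
    simp only [Function.comp]
    rw [(extChartAt 𝓘(ℝ, E) x₀).left_inv hk]
  have hτ' : MDifferentiableAt 𝓘(ℝ, E) 𝓘(ℝ, E)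
      (extChartAt 𝓘(ℝ, E) x₁ ∘ (extChartAt 𝓘(ℝ, E) x₀).symm)
      (extChartAt 𝓘(ℝ, E) x₀ (x * 1)) := by
    rw [mul_one]; exact hτ.mdifferentiableAt
  have h3 := hev.mfderiv_eq (I := 𝓘(ℝ, E)) (I' := 𝓘(ℝ, E))
  have h4 := mfderiv_comp (I := 𝓘(ℝ, E)) (I' := 𝓘(ℝ, E)) (I'' := 𝓘(ℝ, E)) (1 : G)
    (f := fun k : G => extChartAt 𝓘(ℝ, E) x₀ (x * k)) hτ' hf
  unfold leftFrame
  refine (h3.trans h4).trans ?_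
  rw [mfderiv_eq_fderiv]
  simp only [mul_one]
  rfl

theorem leftFrame_isInvertible (x₀ x : G) (h0 : x ∈ (extChartAt 𝓘(ℝ, E) x₀).source) :
    (leftFrame (E := E) x₀ x).IsInvertible := by
  have h1 : MDifferentiableAt 𝓘(ℝ, E) 𝓘(ℝ, E) (extChartAt 𝓘(ℝ, E) x₀) (x * 1) :=
    (contMDiffAt_extChartAt' (n := ∞) (by simpa using h0)).mdifferentiableAt (by simp)
  have hd : ∀ a k : G, MDifferentiableAt 𝓘(ℝ, E) 𝓘(ℝ, E) (fun k : G => a * k) k := fun a k =>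
    (contMDiff_mul_left (I := 𝓘(ℝ, E)) (n := ∞) (a := a)).contMDiffAt.mdifferentiableAt (by simp)
  have h4 := mfderiv_comp (I := 𝓘(ℝ, E)) (I' := 𝓘(ℝ, E)) (I'' := 𝓘(ℝ, E)) (1 : G)
    (f := fun k : G => x * k) h1 (hd x 1)
  have e1 : (mfderiv 𝓘(ℝ, E) 𝓘(ℝ, E) (extChartAt 𝓘(ℝ, E) x₀) (x * 1)).IsInvertible :=
    isInvertible_mfderiv_extChartAt (by simpa using h0)
  have e2 : (mfderiv 𝓘(ℝ, E) 𝓘(ℝ, E) (fun k : G => x * k) 1).IsInvertible := by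
    have A : mfderiv 𝓘(ℝ, E) 𝓘(ℝ, E) ((fun k : G => x⁻¹ * k) ∘ (fun k : G => x * k)) 1 =
        ContinuousLinearMap.id _ _ := by
      have : (fun k : G => x⁻¹ * k) ∘ (fun k : G => x * k) = id := by ext k; simp
      rw [this, id_eq, mfderiv_id]
    have B : mfderiv 𝓘(ℝ, E) 𝓘(ℝ, E) ((fun k : G => x * k) ∘ (fun k : G => x⁻¹ * k)) (x * 1) =
        ContinuousLinearMap.id _ _ := by
      have : (fun k : G => x * k) ∘ (fun k : G => x⁻¹ * k) = id := by ext k; simp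
      rw [this, id_eq, mfderiv_id]
    rw [mfderiv_comp (I' := 𝓘(ℝ, E)) _ (hd _ _) (hd _ _)] at A
    rw [mfderiv_comp (I' := 𝓘(ℝ, E)) _ (hd _ _) (hd _ _), inv_mul_cancel_left] at B
    exact ContinuousLinearMap.IsInvertible.of_inverse B A
  unfold leftFrame
  have := e1.comp e2
  rw [← h4] at this
  exact this

theorem contDiffOn_leftFrame (x₀ : G) :
    ContDiffOn ℝ ∞ (fun y => leftFrame (E := E) x₀ ((extChartAt 𝓘(ℝ, E) x₀).symm y))
      (extChartAt 𝓘(ℝ, E) x₀).target := by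
  set φ := extChartAt 𝓘(ℝ, E) x₀ with hφ
  set φ₁ := extChartAt 𝓘(ℝ, E) (1 : G) with hφ₁
  have hop : IsOpen φ.target := isOpen_extChartAt_target x₀
  have hop1 : IsOpen φ₁.target := isOpen_extChartAt_target (1 : G)
  have hF : ∀ y ∈ φ.target, ContDiffAt ℝ ∞
      (Function.uncurry fun (y u : E) => φ (φ.symm y * φ₁.symm u)) (y, φ₁ 1) := by
    intro y hy
    rw [← contMDiffAt_iff_contDiffAt]
    have m1 : ContMDiffAt 𝓘(ℝ, E) 𝓘(ℝ, E) ∞ φ.symm y :=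
      (contMDiffOn_extChartAt_symm x₀).contMDiffAt (hop.mem_nhds hy)
    have m2 : ContMDiffAt 𝓘(ℝ, E) 𝓘(ℝ, E) ∞ φ₁.symm (φ₁ 1) :=
      (contMDiffOn_extChartAt_symm (1 : G)).contMDiffAt
        (hop1.mem_nhds (mem_extChartAt_target (1 : G)))
    have f1 : ContMDiffAt 𝓘(ℝ, E × E) 𝓘(ℝ, E) ∞ (fun q : E × E => φ.symm q.1) (y, φ₁ 1) :=
      ContMDiffAt.comp (y, φ₁ 1) m1 contDiff_fst.contMDiff.contMDiffAt
    have f2 : ContMDiffAt 𝓘(ℝ, E × E) 𝓘(ℝ, E) ∞ (fun q : E × E => φ₁.symm q.2) (y, φ₁ 1) :=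
      ContMDiffAt.comp (y, φ₁ 1) m2 contDiff_snd.contMDiff.contMDiffAt
    have f3 := f1.mul f2
    have hv : φ.symm y * φ₁.symm (φ₁ 1) = φ.symm y := by
      rw [hφ₁, extChartAt_to_inv, mul_one]
    have m3 : ContMDiffAt 𝓘(ℝ, E) 𝓘(ℝ, E) ∞ φ (φ.symm y * φ₁.symm (φ₁ 1)) := by
      rw [hv]
      exact contMDiffAt_extChartAt' (by simpa [hφ] using φ.map_target hy)
    exact ContMDiffAt.comp (y, φ₁ 1) m3 f3
  have heq : ∀ y ∈ φ.target, leftFrame (E := E) x₀ (φ.symm y) =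
      fderiv ℝ (fun u : E => φ (φ.symm y * φ₁.symm u)) (φ₁ 1) := by
    intro y hy
    have hm := mdiffAt_chart_mul (E := E) x₀ (φ.symm y) 1
      (by simpa [hφ] using φ.map_target hy)
    refine (hm.mfderiv).trans ?_
    rw [modelWithCornersSelf_coe, Set.range_id, fderivWithin_univ]
    rfl
  intro y hy
  have : ContDiffAt ℝ ∞ (fun y => fderiv ℝ (fun u : E => φ (φ.symm y * φ₁.symm u)) (φ₁ 1)) y :=
    ContDiffAt.fderiv (hF y hy) contDiffAt_const (by simp)
  refine (this.contDiffWithinAt).congr (fun z hz => heq z hz) (heq y hy)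

variable [FiniteDimensional ℝ E]

theorem contDiffOn_chartForm {h : ℕ} (α : Form E G h) (x₀ : G) :
    ContDiffOn ℝ ∞ (chartForm α x₀) (extChartAt 𝓘(ℝ, E) x₀).target := by
  intro y hy
  have hop := isOpen_extChartAt_target (I := 𝓘(ℝ, E)) x₀
  have := FiniteDimensional.complete ℝ E
  refine ContDiffAt.contDiffWithinAt ?_
  refine contDiffAt_comp_covec ?_ ?_
  · rw [← contMDiffAt_iff_contDiffAt]
    exact ContMDiffAt.comp y α.contMDiff.contMDiffAt
      ((contMDiffOn_extChartAt_symm x₀).contMDiffAt (hop.mem_nhds hy))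
  · exact ContDiffAt.comp y (leftFrame_isInvertible x₀ _
      ((extChartAt 𝓘(ℝ, E) x₀).map_target hy)).contDiffAt_map_inverse
      ((contDiffOn_leftFrame x₀).contDiffAt (hop.mem_nhds hy))

theorem contDiffAt_chartForm {h : ℕ} (α : Form E G h) (x₀ : G) {y : E}
    (hy : y ∈ (extChartAt 𝓘(ℝ, E) x₀).target) : ContDiffAt ℝ ∞ (chartForm α x₀) y :=
  (contDiffOn_chartForm α x₀).contDiffAt ((isOpen_extChartAt_target x₀).mem_nhds hy)

theorem dFun_eq {h : ℕ} (α : Form E G h) (x₀ x : G) (h0 : x ∈ (extChartAt 𝓘(ℝ, E) x₀).source) :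
    dFun α x = (extDeriv (chartForm α x₀) (extChartAt 𝓘(ℝ, E) x₀ x)).compContinuousLinearMap
      (leftFrame x₀ x) := by
  set φ := extChartAt 𝓘(ℝ, E) x₀ with hφ
  set ψ := extChartAt 𝓘(ℝ, E) x with hψ
  have hx : x ∈ ψ.source := mem_extChartAt_source x
  have hxt : ψ x ∈ ψ.target := mem_extChartAt_target x
  have hτx : (φ ∘ ψ.symm) (ψ x) = φ x := by simp [ψ.left_inv hx]
  have hopt : IsOpen ψ.target := isOpen_extChartAt_target x
  have hsrc : ∀ᶠ y in 𝓝 (ψ x), y ∈ ψ.target ∧ ψ.symm y ∈ φ.source := by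
    have hc : ContinuousAt ψ.symm (ψ x) := continuousAt_extChartAt_symm x
    have : φ.source ∈ 𝓝 (ψ.symm (ψ x)) := by
      rw [ψ.left_inv hx]; exact extChartAt_source_mem_nhds' h0
    exact Filter.Eventually.and (hopt.mem_nhds hxt) (hc this)
  have hev : chartForm α x =ᶠ[𝓝 (ψ x)] fun y =>
      (chartForm α x₀ ((φ ∘ ψ.symm) y)).compContinuousLinearMap (fderiv ℝ (φ ∘ ψ.symm) y) := by
    filter_upwards [hsrc] with y hy
    have e1 : φ.symm ((φ ∘ ψ.symm) y) = ψ.symm y := φ.left_inv hy.2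
    have e2 := leftFrame_trans (E := E) x x₀ (ψ.symm y) (ψ.map_target hy.1) hy.2
    have e3 : ψ (ψ.symm y) = y := ψ.right_inv hy.1
    have i1 := leftFrame_isInvertible (E := E) x (ψ.symm y) (ψ.map_target hy.1)
    have i2 := leftFrame_isInvertible (E := E) x₀ (ψ.symm y) hy.2
    rw [← hφ, ← hψ, e3] at e2
    have e4 : (leftFrame (E := E) x₀ (ψ.symm y)).inverse.comp (fderiv ℝ (φ ∘ ψ.symm) y) =
        (leftFrame (E := E) x (ψ.symm y)).inverse := by
      ext v
      obtain ⟨w, rfl⟩ := i1.surjective v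
      have : fderiv ℝ (φ ∘ ψ.symm) y (leftFrame x (ψ.symm y) w) = leftFrame x₀ (ψ.symm y) w := by
        rw [e2]; rfl
      simp [this, i1.inverse_apply_self, i2.inverse_apply_self]
    unfold chartForm
    rw [← hφ, ← hψ, e1, ← e4]
    rfl
  have hpb : extDeriv (fun y => (chartForm α x₀ ((φ ∘ ψ.symm) y)).compContinuousLinearMap
      (fderiv ℝ (φ ∘ ψ.symm) y)) (ψ x) = (extDeriv (chartForm α x₀)
      ((φ ∘ ψ.symm) (ψ x))).compContinuousLinearMap (fderiv ℝ (φ ∘ ψ.symm) (ψ x)) :=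
    extDeriv_pullback (r := ∞)
    (by rw [hτx]; exact (contDiffAt_chartForm α x₀ (φ.map_source h0)).differentiableAt (by simp))
    (contDiffAt_transition x x₀ hxt (by rw [ψ.left_inv hx]; exact h0)) (by simpa using ENat.LEInfty.out)
  unfold dFun
  rw [← hψ, hev.extDeriv_eq, hpb, hτx, leftFrame_trans (E := E) x x₀ x hx h0]
  rfl

theorem contMDiff_dFun {h : ℕ} (α : Form E G h) :
    ContMDiff 𝓘(ℝ, E) 𝓘(ℝ, Covec E (h + 1)) ∞ (dFun α) := by
  intro x₀
  set φ := extChartAt 𝓘(ℝ, E) x₀ with hφ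
  have hxt : φ x₀ ∈ φ.target := mem_extChartAt_target x₀
  have hop : IsOpen φ.target := isOpen_extChartAt_target x₀
  have h1 : ContDiffAt ℝ ∞ (fun y => (extDeriv (chartForm α x₀) y).compContinuousLinearMap
      (leftFrame x₀ (φ.symm y))) (φ x₀) :=
    contDiffAt_comp_covec (contDiffAt_extDeriv (contDiffAt_chartForm α x₀ hxt))
      ((contDiffOn_leftFrame x₀).contDiffAt (hop.mem_nhds hxt))
  have h2 : ContMDiffAt 𝓘(ℝ, E) 𝓘(ℝ, Covec E (h + 1)) ∞ (fun x =>
      (extDeriv (chartForm α x₀) (φ x)).compContinuousLinearMap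
      (leftFrame x₀ (φ.symm (φ x)))) x₀ :=
    ContMDiffAt.comp x₀ h1.contMDiffAt contMDiffAt_extChartAt
  refine h2.congr_of_eventuallyEq ?_
  filter_upwards [extChartAt_source_mem_nhds (I := 𝓘(ℝ, E)) x₀] with x hx
  rw [dFun_eq α x₀ x hx, ← hφ, φ.left_inv hx]

/-- The de Rham differential `d : Ω^h → Ω^{h+1}`. -/
def deRham (h : ℕ) : Form E G h →ₗ[ℝ] Form E G (h + 1) where
  toFun α := ⟨dFun α, contMDiff_dFun α⟩
  map_add' α β := by
    ext1 x
    have hx := mem_extChartAt_target (I := 𝓘(ℝ, E)) x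
    have e : chartForm (⇑(α + β)) x = chartForm α x + chartForm β x := by
      funext y; ext v; rfl
    change dFun (⇑(α + β)) x = dFun α x + dFun β x
    unfold dFun
    rw [e, extDeriv_add ((contDiffAt_chartForm α x hx).differentiableAt (by simp))
      ((contDiffAt_chartForm β x hx).differentiableAt (by simp))]
    rfl
  map_smul' c α := by
    ext1 x
    have e : chartForm (⇑(c • α)) x = c • chartForm α x := by
      funext y; ext v; rfl
    change dFun (⇑(c • α)) x = c • dFun α x
    unfold dFun
    rw [e, extDeriv_smul]
    rfl

theorem deRham_deRham {h : ℕ} (α : Form E G h) :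
    deRham (E := E) (G := G) (h + 1) (deRham (E := E) (G := G) h α) = 0 := by
  ext1 x
  set φ := extChartAt 𝓘(ℝ, E) x with hφ
  have hxt : φ x ∈ φ.target := mem_extChartAt_target x
  have hop : IsOpen φ.target := isOpen_extChartAt_target x
  have hev : chartForm (dFun α) x =ᶠ[𝓝 (φ x)] extDeriv (chartForm α x) := by
    filter_upwards [hop.mem_nhds hxt] with y hy
    have i := leftFrame_isInvertible (E := E) x (φ.symm y) (φ.map_target hy)
    unfold chartForm
    rw [← hφ, dFun_eq α x _ (φ.map_target hy), ← hφ, φ.right_inv hy]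
    ext v
    simp only [ContinuousAlternatingMap.compContinuousLinearMap_apply, Function.comp_def,
      i.self_apply_inverse]
    rfl
  change dFun (dFun α) x = 0
  unfold dFun
  rw [show (fun x => (extDeriv (chartForm (⇑α) x) (extChartAt 𝓘(ℝ, E) x x)).compContinuousLinearMap
    (leftFrame x x)) = dFun α from rfl, ← hφ, hev.extDeriv_eq,
    extDeriv_extDeriv_apply (contDiffAt_chartForm α x hxt) (by simpa using ENat.LEInfty.out)]
  rfl

end Geometry

section SpectralSequence
variable {M : Type*} [AddCommGroup M] [Module ℝ M]

/-- The class of `x ∈ Z` in `Z / (B ∩ Z)`. -/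
def cls (Z B : Submodule ℝ M) (x : M) (hx : x ∈ Z) : ↥Z ⧸ B.submoduleOf Z :=
  Submodule.Quotient.mk ⟨x, hx⟩

/-- The `r`-cycles `F_p ∩ d⁻¹(F_{p+r})` of a differential `d` with a decreasing filtration `F`. -/
def cycles (d : Module.End ℝ M) (F : ℤ → Submodule ℝ M) (r : ℕ) (p : ℤ) : Submodule ℝ M :=
  F p ⊓ (F (p + r)).comap d

/-- The `r`-boundaries of a differential with a decreasing filtration. -/
def boundaries (d : Module.End ℝ M) (F : ℤ → Submodule ℝ M) : ℕ → ℤ → Submodule ℝ M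
  | 0, p => cycles d F 0 (p + 1)
  | r + 1, p => cycles d F r (p + 1) ⊔ (cycles d F r (p - r)).map d

/-- The term `E_r^{p,*}` of the spectral sequence of a filtered complex. -/
abbrev Page (d : Module.End ℝ M) (F : ℤ → Submodule ℝ M) (r : ℕ) (p : ℤ) : Type _ :=
  ↥(cycles d F r p) ⧸ (boundaries d F r p).submoduleOf (cycles d F r p)

theorem map_cycles (d : Module.End ℝ M) (hd : ∀ x, d (d x) = 0) (F : ℤ → Submodule ℝ M)
    (r : ℕ) (p : ℤ) : ∀ x ∈ cycles d F r p, d x ∈ cycles d F r (p + r) := by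
  intro x hx
  refine ⟨hx.2, ?_⟩
  simp [hd]

theorem map_boundaries (d : Module.End ℝ M) (hd : ∀ x, d (d x) = 0) (F : ℤ → Submodule ℝ M)
    (r : ℕ) (p : ℤ) : ∀ x ∈ boundaries d F r p, d x ∈ boundaries d F r (p + r) := by
  intro x hx
  cases r with
  | zero =>
    have h := map_cycles d hd F 0 (p + 1) x hx
    simpa [boundaries] using h
  | succ r =>
    obtain ⟨u, hu, v, ⟨c, _, rfl⟩, rfl⟩ := Submodule.mem_sup.1 hx
    refine Submodule.mem_sup_right ⟨u, ?_, by simp [hd]⟩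
    have e : p + ((r + 1 : ℕ) : ℤ) - r = p + 1 := by push_cast; ring
    rw [e]
    exact hu

/-- The differential of the `r`-th page, `[x] ↦ [d x]`. -/
def pageDiff (d : Module.End ℝ M) (hd : ∀ x, d (d x) = 0) (F : ℤ → Submodule ℝ M)
    (r : ℕ) (p : ℤ) : Page d F r p →ₗ[ℝ] Page d F r (p + r) :=
  Submodule.mapQ _ _ (d.restrict (map_cycles d hd F r p))
    (fun x hx => map_boundaries d hd F r p x hx)

end SpectralSequence

section LieAlgebra
variable (E : Type*) [NormedAddCommGroup E] [NormedSpace ℝ E]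
  (G : Type*) [TopologicalSpace G] [ChartedSpace E G] [Group G]

/-- A stratification `𝔤 = V_1 ⊕ ⋯ ⊕ V_s`, `[V_1, V_i] = V_{i+1}`, `V_s ≠ 0`, `V_k = 0` for `k > s`,
of the Lie algebra of a Lie group. -/
structure Stratification where
  layer : ℕ → Submodule ℝ (GroupLieAlgebra 𝓘(ℝ, E) G)
  step : ℕ
  isInternal : DirectSum.IsInternal layer
  layer_zero : layer 0 = ⊥
  bracket_mem : ∀ (i j : ℕ) (X Y : GroupLieAlgebra 𝓘(ℝ, E) G),
    X ∈ layer i → Y ∈ layer j → ⁅X, Y⁆ ∈ layer (i + j)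
  layer_succ : ∀ i : ℕ, 1 ≤ i → layer (i + 1) =
    Submodule.span ℝ {Z | ∃ X ∈ layer 1, ∃ Y ∈ layer i, Z = ⁅X, Y⁆}
  layer_step : layer step ≠ ⊥
  layer_of_gt : ∀ k : ℕ, step < k → layer k = ⊥

variable {E G}

/-- A basis `X_1, …, X_n` of the Lie algebra adapted to the stratification: `X_i` lies in the layer
`V_{w i}`. The metric is the left-invariant one for which this basis is orthonormal; the metrics
obtained in this way are all those for which the layers are pairwise orthogonal. -/
structure AdaptedBasis (S : Stratification E G) (n : ℕ) where
  basis : Module.Basis (Fin n) ℝ (GroupLieAlgebra 𝓘(ℝ, E) G)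
  weight : Fin n → ℕ
  mem_layer : ∀ i, basis i ∈ S.layer (weight i)

end LieAlgebra

section Covectors
variable {E : Type*} [NormedAddCommGroup E] [NormedSpace ℝ E] {n : ℕ}

/-- Strictly increasing multi-indices `j_1 < ⋯ < j_h`. -/
def incr (h n : ℕ) : Finset (Fin h → Fin n) :=
  open Classical in Finset.univ.filter StrictMono

/-- `θ_{j_1} ∧ ⋯ ∧ θ_{j_h}` for the basis `θ` dual to `b`. -/
def wedge [FiniteDimensional ℝ E] (b : Module.Basis (Fin n) ℝ E) {h : ℕ} (J : Fin h → Fin n) : Covec E h :=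
  { (Matrix.detRowAlternating (R := ℝ) (n := Fin h)).compLinearMap
      (LinearMap.pi fun i => b.coord (J i)) with
    cont := by
      change Continuous fun v : Fin h → E =>
        Matrix.det (Matrix.of fun i j => b.coord (J j) (v i))
      refine Continuous.matrix_det (continuous_matrix fun i j => ?_)
      exact (LinearMap.continuous_of_finiteDimensional (b.coord (J j))).comp (continuous_apply i) }

/-- The inner product of `h`-covectors for which the `θ_{j_1} ∧ ⋯ ∧ θ_{j_h}`, `j_1 < ⋯ < j_h`,
are orthonormal. -/
def covInner (b : Module.Basis (Fin n) ℝ E) (h : ℕ) : LinearMap.BilinForm ℝ (Covec E h) :=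
  LinearMap.mk₂ ℝ (fun ξ η => ∑ J ∈ incr h n, ξ (fun i => b (J i)) * η (fun i => b (J i)))
    (fun _ _ _ => by simp [add_mul, Finset.sum_add_distrib])
    (fun _ _ _ => by simp [Finset.mul_sum, mul_assoc])
    (fun _ _ _ => by simp [mul_add, Finset.sum_add_distrib])
    (fun _ _ _ => by simp [Finset.mul_sum, mul_left_comm])

theorem eq_zero_of_incr (b : Module.Basis (Fin n) ℝ E) {h : ℕ} (ξ : Covec E h)
    (hξ : ∀ J ∈ incr h n, ξ (fun i => b (J i)) = 0) : ξ = 0 := by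
  apply evalBasis_injective b h
  rw [map_zero]
  funext J
  change ξ (fun i => b (J i)) = 0
  by_cases hJ : Function.Injective J
  · have hs : StrictMono (J ∘ Tuple.sort J) :=
      (Tuple.monotone_sort J).strictMono_of_injective (hJ.comp (Tuple.sort J).injective)
    have h0 := hξ (J ∘ Tuple.sort J) (by simp [incr, hs])
    have h1 := ξ.toAlternatingMap.map_perm (fun i => b (J i)) (Tuple.sort J)
    have h2 : ξ.toAlternatingMap ((fun i => b (J i)) ∘ Tuple.sort J) = 0 := h0
    rw [h2] at h1
    rcases Int.units_eq_one_or (Equiv.Perm.sign (Tuple.sort J)) with hu | hu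
    · rw [hu] at h1
      simpa using h1.symm
    · rw [hu] at h1
      simpa using h1.symm
  · obtain ⟨i, j, hij, hne⟩ : ∃ i j, J i = J j ∧ i ≠ j := by
      simpa [Function.Injective] using hJ
    exact ξ.map_eq_zero_of_eq _ (by simp [hij]) hne

theorem isCompl_orthogonal [FiniteDimensional ℝ E] (b : Module.Basis (Fin n) ℝ E) (h : ℕ) (W : Submodule ℝ (Covec E h)) :
    IsCompl W ((covInner b h).orthogonal W) := by
  have hr : (covInner b h).IsRefl := by
    intro ξ η he
    rw [← he]
    simp [covInner, mul_comm]
  rw [LinearMap.BilinForm.isCompl_orthogonal_iff_disjoint hr, Submodule.disjoint_def]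
  intro ξ h1 h2
  have h3 : ∑ J ∈ incr h n, ξ (fun i => b (J i)) * ξ (fun i => b (J i)) = 0 := h2 ξ h1
  rw [Finset.sum_eq_zero_iff_of_nonneg (fun _ _ => mul_self_nonneg _)] at h3
  exact eq_zero_of_incr b ξ fun J hJ => mul_self_eq_zero.1 (h3 J hJ)

/-- The component of weight `a` of an `h`-covector, `θ_{j_1} ∧ ⋯ ∧ θ_{j_h}` having weight
`w j_1 + ⋯ + w j_h`. -/
def covProj [FiniteDimensional ℝ E] (b : Module.Basis (Fin n) ℝ E) (w : Fin n → ℕ) (h : ℕ)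
    (a : ℤ) : Covec E h →ₗ[ℝ] Covec E h where
  toFun ξ := ∑ J ∈ (incr h n).filter (fun J => ∑ i, (w (J i) : ℤ) = a),
    ξ (fun i => b (J i)) • wedge b J
  map_add' _ _ := by simp [add_smul, Finset.sum_add_distrib]
  map_smul' _ _ := by simp [mul_smul, Finset.smul_sum]

/-- The inverse of `f : V → W` with respect to inner products: it sends `β` to the unique
`α ∈ (ker f)^⊥` with `f α - β ∈ (im f)^⊥`. It is the composite of the orthogonal projection onto
`im f`, the inverse of `V / ker f ≅ im f`, and `V / ker f ≅ (ker f)^⊥`. -/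
def partialInverse [FiniteDimensional ℝ E] {h k : ℕ} (b : Module.Basis (Fin n) ℝ E)
    (f : Covec E h →ₗ[ℝ] Covec E k) : Covec E k →ₗ[ℝ] Covec E h :=
  ((covInner b h).orthogonal (LinearMap.ker f)).subtype ∘ₗ
    (Submodule.quotientEquivOfIsCompl _ _
      (isCompl_orthogonal b h (LinearMap.ker f))).toLinearMap ∘ₗ
    f.quotKerEquivRange.symm.toLinearMap ∘ₗ
    Submodule.projectionOnto _ _ (isCompl_orthogonal b k (LinearMap.range f))

end Covectors

section TotalComplex
variable (E : Type*) [NormedAddCommGroup E] [NormedSpace ℝ E]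
  (G : Type*) [TopologicalSpace G] [ChartedSpace E G]

/-- All smooth forms `Ω^* = ⨁_h Ω^h`. As `Ω^h = 0` for `h > dim G`, the sum is the product. -/
def Forms : Type _ := (h : ℕ) → Form E G h

instance : AddCommGroup (Forms E G) := inferInstanceAs (AddCommGroup ((h : ℕ) → Form E G h))

instance : Module ℝ (Forms E G) := inferInstanceAs (Module ℝ ((h : ℕ) → Form E G h))

variable {E G}

/-- Forms that are homogeneous of degree `h`. -/
def Forms.degree (h : ℕ) : Submodule ℝ (Forms E G) where
  carrier := {α | ∀ k, k ≠ h → α k = 0}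
  zero_mem' _ _ := rfl
  add_mem' {α β} ha hb k hk := by
    change α k + β k = 0
    rw [ha k hk, hb k hk, add_zero]
  smul_mem' c α ha k hk := by
    change c • α k = 0
    rw [ha k hk, smul_zero]

/-- The operator of degree `1` on `Ω^*` with components `T h : Ω^h → Ω^{h+1}`. -/
def Forms.raise (T : ∀ h, Form E G h →ₗ[ℝ] Form E G (h + 1)) : Module.End ℝ (Forms E G) :=
  { toFun := fun α h => match h with
      | 0 => 0
      | k + 1 => T k (α k)
    map_add' := fun α β => by
      funext h
      cases h with
      | zero => exact (add_zero _).symm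
      | succ k => exact (T k).map_add (α k) (β k)
    map_smul' := fun c α => by
      funext h
      cases h with
      | zero => exact (smul_zero c).symm
      | succ k => exact (T k).map_smul c (α k) }

/-- The operator of degree `-1` on `Ω^*` with components `T h : Ω^{h+1} → Ω^h`. -/
def Forms.lower (T : ∀ h, Form E G (h + 1) →ₗ[ℝ] Form E G h) : Module.End ℝ (Forms E G) :=
  { toFun := fun α h => T h (α (h + 1))
    map_add' := fun α β => funext fun h => (T h).map_add (α (h + 1)) (β (h + 1))
    map_smul' := fun c α => funext fun h => (T h).map_smul c (α (h + 1)) }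

/-- The operator of degree `0` on `Ω^*` with components `T h : Ω^h → Ω^h`. -/
def Forms.keep (T : ∀ h, Form E G h →ₗ[ℝ] Form E G h) : Module.End ℝ (Forms E G) :=
  { toFun := fun α h => T h (α h)
    map_add' := fun α β => funext fun h => (T h).map_add (α h) (β h)
    map_smul' := fun c α => funext fun h => (T h).map_smul c (α h) }

variable [FiniteDimensional ℝ E]

/-- A linear map of covectors acting pointwise on forms. -/
def pointwise {h k : ℕ} (T : Covec E h →ₗ[ℝ] Covec E k) : Form E G h →ₗ[ℝ] Form E G k where
  toFun α := ⟨fun x => T (α x),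
    (LinearMap.toContinuousLinearMap T).contMDiff.comp α.contMDiff⟩
  map_add' α β := by ext1 x; exact T.map_add (α x) (β x)
  map_smul' c α := by ext1 x; exact T.map_smul c (α x)

variable [Group G] [LieGroup 𝓘(ℝ, E) ∞ G]

variable (E G) in
/-- The de Rham differential on `Ω^*`. -/
def d : Module.End ℝ (Forms E G) := Forms.raise deRham

theorem d_d (α : Forms E G) : d E G (d E G α) = 0 := by
  funext h
  match h with
  | 0 => rfl
  | 1 => exact (deRham (E := E) (G := G) 0).map_zero
  | h + 2 => exact deRham_deRham (α h)

variable (E G) in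
/-- The action of `d` on left-invariant `h`-forms, as a map `Λ^h 𝔤* → Λ^{h+1} 𝔤*`. -/
def covD0 (h : ℕ) : Covec E h →ₗ[ℝ] Covec E (h + 1) where
  toFun ξ := deRham (E := E) (G := G) h ⟨fun _ => ξ, contMDiff_const⟩ 1
  map_add' ξ η := by
    exact congrArg (fun β : Form E G (h + 1) => β 1)
      ((deRham (E := E) (G := G) h).map_add ⟨fun _ => ξ, contMDiff_const⟩
        ⟨fun _ => η, contMDiff_const⟩)
  map_smul' c ξ := by
    exact congrArg (fun β : Form E G (h + 1) => β 1)
      ((deRham (E := E) (G := G) h).map_smul c ⟨fun _ => ξ, contMDiff_const⟩)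

namespace AdaptedBasis
variable {S : Stratification E G} {n : ℕ} (A : AdaptedBasis S n)

/-- The adapted basis, as a basis of the model space `E = T_1 G`. -/
def frame : Module.Basis (Fin n) ℝ E := A.basis

/-- The homogeneous dimension `Q`, the largest weight of a form. -/
def homDim : ℕ := ∑ i, A.weight i

/-- The component `(α)_a` of weight `a` of a form. -/
def wproj (a : ℤ) : Module.End ℝ (Forms E G) :=
  Forms.keep fun h => pointwise (covProj A.frame A.weight h a)

/-- The forms of pure weight `a`, that is `Ω^{a,*}`. -/
def weightForms (a : ℤ) : Submodule ℝ (Forms E G) := LinearMap.range (A.wproj a)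

/-- The filtration by weights: the forms of weight at least `p`. -/
def filtration (p : ℤ) : Submodule ℝ (Forms E G) :=
  ⨅ a : ℤ, ⨅ _ : a < p, LinearMap.ker (A.wproj a)

/-- The part `d_i` of the de Rham differential that increases the weight by `i`. -/
def dW (i : ℕ) : Module.End ℝ (Forms E G) :=
  ∑ a ∈ Finset.range (A.homDim + 1), A.wproj ((a : ℤ) + i) * d E G * A.wproj a

/-- Pointwise orthogonality of forms. -/
def Ortho (α β : Forms E G) : Prop :=
  ∀ (h : ℕ) (x : G), covInner A.frame h (α h x) (β h x) = 0

/-- The operator `d_0⁻¹`. -/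
def d0inv : Module.End ℝ (Forms E G) :=
  Forms.lower fun h => pointwise (partialInverse A.frame (covD0 E G h))

/-- The Rumin forms `E_0 = ker d_0 ∩ (im d_0)^⊥`. -/
def ruminForms : Submodule ℝ (Forms E G) where
  carrier := {α | A.dW 0 α = 0 ∧ ∀ β, A.Ortho α (A.dW 0 β)}
  zero_mem' := ⟨map_zero _, fun β h x => LinearMap.map_zero₂ _ _⟩
  add_mem' {α α'} ha hb := ⟨by rw [map_add, ha.1, hb.1, add_zero], fun β h x => by
    change covInner A.frame h (α h x + α' h x) (A.dW 0 β h x) = 0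
    rw [LinearMap.map_add₂, ha.2 β h x, hb.2 β h x, add_zero]⟩
  smul_mem' c α ha := ⟨by rw [map_smul, ha.1, smul_zero], fun β h x => by
    change covInner A.frame h (c • α h x) (A.dW 0 β h x) = 0
    rw [LinearMap.map_smul₂, ha.2 β h x, smul_zero]⟩

/-- `Π_{E_0} = Id - d_0 d_0⁻¹ - d_0⁻¹ d_0`. -/
def projE0 : Module.End ℝ (Forms E G) := 1 - A.dW 0 * A.d0inv - A.d0inv * A.dW 0

/-- The operator `d_0⁻¹ (d - d_0)`. It increases the weight, and all weights lie in `{0, …, Q}`. -/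
def nilOp : Module.End ℝ (Forms E G) := A.d0inv * (d E G - A.dW 0)

/-- `P = ∑_k (-1)^k [d_0⁻¹ (d - d_0)]^k`; the terms with `k > Q` vanish. -/
def P : Module.End ℝ (Forms E G) :=
  ∑ k ∈ Finset.range (A.homDim + 1), (-1 : ℝ) ^ k • A.nilOp ^ k

/-- `Π_E = Id - d P d_0⁻¹ - P d_0⁻¹ d`. -/
def projE : Module.End ℝ (Forms E G) := 1 - d E G * A.P * A.d0inv - A.P * A.d0inv * d E G

/-- The Rumin differential `d_c = Π_{E_0} d Π_E`. -/
def dc : Module.End ℝ (Forms E G) := A.projE0 * d E G * A.projE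

/-- `∑_I (d_0⁻¹ d_{i_1}) ⋯ (d_0⁻¹ d_{i_m})` over the `I = (i_1, …, i_m)` with positive entries and
`i_1 + ⋯ + i_m = j`. -/
def words (m j : ℕ) : Module.End ℝ (Forms E G) :=
  ∑ I ∈ (Finset.Nat.antidiagonalTuple m j).filter (fun I => ∀ k, 1 ≤ I k),
    (List.ofFn fun k => A.d0inv * A.dW (I k)).prod

/-- `∑_{m=1}^j (-1)^{m-1} ∑_{|I| = j} (d_0⁻¹ d)_I`. -/
def zOp (j : ℕ) : Module.End ℝ (Forms E G) :=
  ∑ m ∈ Finset.Icc 1 j, (-1 : ℝ) ^ (m - 1) • A.words m j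

/-- `D_r = d_r - ∑_{i=1}^{r-1} d_i ∑_{m=1}^{r-i} (-1)^{m-1} ∑_{|I| = r-i} (d_0⁻¹ d)_I`. -/
def diffPart (r : ℕ) : Module.End ℝ (Forms E G) :=
  A.dW r - ∑ i ∈ Finset.Ico 1 r, A.dW i * A.zOp (r - i)

/-- `z` is a system of forms `z_{p+j}` of weight `p + j`, `1 ≤ j ≤ r - 1`, exhibiting `x` as an
element of `Z_r^{p,*}`. -/
def IsZigzag (r : ℕ) (p : ℤ) (x : Forms E G) (z : ℕ → Forms E G) : Prop :=
  (∀ j, 1 ≤ j → j < r → z j ∈ A.weightForms (p + j)) ∧ A.dW 0 x = 0 ∧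
    ∀ m, 1 ≤ m → m < r → A.dW m x = ∑ i ∈ Finset.range m, A.dW i (z (m - i))

/-- The submodule `Z_r^{p,*}` of `Ω^{p,*}`. -/
def Z (r : ℕ) (p : ℤ) : Submodule ℝ (Forms E G) where
  carrier := {x | x ∈ A.weightForms p ∧ ∃ z, A.IsZigzag r p x z}
  zero_mem' := ⟨Submodule.zero_mem _, 0, fun _ _ _ => Submodule.zero_mem _, map_zero _,
    fun _ _ _ => by simp⟩
  add_mem' := by
    rintro x y ⟨hx, z, h1, h2, h3⟩ ⟨hy, z', h1', h2', h3'⟩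
    refine ⟨Submodule.add_mem _ hx hy, z + z', fun j a b => Submodule.add_mem _ (h1 j a b)
      (h1' j a b), by rw [map_add, h2, h2', add_zero], fun m a b => ?_⟩
    rw [map_add, h3 m a b, h3' m a b, ← Finset.sum_add_distrib]
    simp
  smul_mem' := by
    rintro c x ⟨hx, z, h1, h2, h3⟩
    refine ⟨Submodule.smul_mem _ c hx, c • z, fun j a b => Submodule.smul_mem _ c (h1 j a b),
      by rw [map_smul, h2, smul_zero], fun m a b => ?_⟩
    rw [map_smul, h3 m a b, Finset.smul_sum]
    simp

/-- The submodule `B_r^{p,*}` of `Ω^{p,*}`: the `x = ∑_{k=0}^{r-1} d_k c_{p-k}`, with `c_{p-k}` of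
weight `p - k`, such that `∑_{k=l}^{r-1} d_{k-l} c_{p-k} = 0` for `1 ≤ l ≤ r - 1`. -/
def B (r : ℕ) (p : ℤ) : Submodule ℝ (Forms E G) where
  carrier := {x | ∃ c : ℕ → Forms E G, (∀ k, k < r → c k ∈ A.weightForms (p - k)) ∧
    x = ∑ k ∈ Finset.range r, A.dW k (c k) ∧
    ∀ l, 1 ≤ l → l < r → 0 = ∑ k ∈ Finset.Ico l r, A.dW (k - l) (c k)}
  zero_mem' := ⟨0, fun _ _ => Submodule.zero_mem _, by simp, fun _ _ _ => by simp⟩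
  add_mem' := by
    rintro x y ⟨c, h1, rfl, h3⟩ ⟨c', h1', rfl, h3'⟩
    refine ⟨c + c', fun k hk => Submodule.add_mem _ (h1 k hk) (h1' k hk),
      by simp [Finset.sum_add_distrib], fun l a b => ?_⟩
    simp [Finset.sum_add_distrib, ← h3 l a b, ← h3' l a b]
  smul_mem' := by
    rintro t x ⟨c, h1, rfl, h3⟩
    refine ⟨t • c, fun k hk => Submodule.smul_mem _ t (h1 k hk),
      by simp [Finset.smul_sum], fun l a b => ?_⟩
    simp [← Finset.smul_sum, ← h3 l a b]

/-- The term `E_r^{p,*}` of the spectral sequence of the filtration by weights. -/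
abbrev specPage (r : ℕ) (p : ℤ) : Type _ := Page (d E G) A.filtration r p

/-- The quotient `Z_r^{p,*} / B_r^{p,*}`. -/
abbrev ZB (r : ℕ) (p : ℤ) : Type _ := ↥(A.Z r p) ⧸ (A.B r p).submoduleOf (A.Z r p)

/-- The differential of the `r`-th page of the spectral sequence of the filtration by weights. -/
def specDiff (r : ℕ) (p : ℤ) : A.specPage r p →ₗ[ℝ] A.specPage r (p + r) :=
  pageDiff (d E G) d_d A.filtration r p

/-- The differential of the `r`-th page, read in the quotients `Z_r / B_r` through isomorphisms
`ψ : E_r ≅ Z_r / B_r`. -/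
def partialD (r : ℕ) (ψ : ∀ p : ℤ, A.specPage r p ≃ₗ[ℝ] A.ZB r p) (p : ℤ) :
    A.ZB r p →ₗ[ℝ] A.ZB r (p + r) :=
  (ψ (p + r)).toLinearMap ∘ₗ A.specDiff r p ∘ₗ (ψ p).symm.toLinearMap

end AdaptedBasis

end TotalComplex

end Carnot

end

set_option linter.unusedSectionVars false

/-! In a left-invariant frame, Koszul's formula splits `d` into derivatives of coefficients along
frame vectors and a bracket term. The bracket respects the grading, so the second term keeps the
weight. Each derivative uses up a frame vector of weight at least 1, so the first raises it. Hence
`d = d_0 + d_1 + ⋯` with `d_0` the pointwise algebraic part (`evalAt_dW_zero`). Since different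
weights are orthogonal, `d_0⁻¹` keeps the weight too (`wproj_d0inv`), and it satisfies the
identities of a Moore–Penrose inverse together with `d_0⁻¹ d_0⁻¹ = 0`.

Therefore `T = d_0⁻¹ (d - d_0)` strictly raises the weight, is nilpotent, and `P = (1 + T)⁻¹` keeps
the leading component of a form. The values `Y` of `Π_E` satisfy `d_0⁻¹ Y = 0` and `d_0⁻¹ d Y = 0`.
For such `Y` one has `Π_{E_0} Y = (1 + T) Y`, so `P Π_{E_0} Y = Y`; on `E_0`, conversely, `Π_E = P`.
Together these give `P d_c = d P` on `E_0` (`P_dc`), the identity behind the whole comparison.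

Expanding `P` by weight gives components `-ζ_m x` (`wproj_P`), through the recursion `ζ_j = d_0⁻¹
D_j` (`zOp_eq`). The components of `d P x` are then `D_r x - d_0 ζ_r x`, and `Π_{E_0}` removes the
last term: this is the formula for `d_c`.

On the side of the spectral sequence, the components of an `r`-cycle are, up to sign, a solution of
`(⋆)`, and `x - ∑ z_{p+j}` is the cycle of a solution; boundaries are treated in the same way. This
gives `E_r ≅ Z_r / B_r` and the formula for `∂_r`. Orthogonality to `ker d_0` makes `(⋆)` solvable
recursively by `d_0⁻¹`, with the unique outcome `ζ_j x`. If `y ∈ E_0 ∩ F_p` has `d_c y ∈ F_{p+r}`,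
then `P y` is an `r`-cycle with leading component `(y)_p`, and `d P y = P d_c y` has leading
component `(d_c y)_{p+r}`. Every class arises so, because `X - Π_E X` is an `r`-boundary for every
`r`-cycle `X` (`sub_projE_mem_boundaries`). -/

noncomputable section
namespace Carnot

/-! ### Koszul's formula in the left-invariant trivialisation -/

section MaurerCartan
open VectorField

variable {E : Type*} [NormedAddCommGroup E] [NormedSpace ℝ E]
  {G : Type*} [TopologicalSpace G] [ChartedSpace E G] [Group G]

variable (G) in
/-- The Lie bracket of the Lie algebra of `G`, on the model space. -/
def modelBracket (v w : E) : E :=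
  Bracket.bracket (L := GroupLieAlgebra 𝓘(ℝ, E) G) (M := GroupLieAlgebra 𝓘(ℝ, E) G) v w

variable [LieGroup 𝓘(ℝ, E) ∞ G]

theorem leftFrame_apply (x₀ x : G) (h0 : x ∈ (extChartAt 𝓘(ℝ, E) x₀).source) (v : E) :
    leftFrame x₀ x v = mfderiv 𝓘(ℝ, E) 𝓘(ℝ, E) (extChartAt 𝓘(ℝ, E) x₀) x
      (mulInvariantVectorField (I := 𝓘(ℝ, E)) (v : GroupLieAlgebra 𝓘(ℝ, E) G) x) := by
  have h1 : MDifferentiableAt 𝓘(ℝ, E) 𝓘(ℝ, E) (extChartAt 𝓘(ℝ, E) x₀) (x * 1) :=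
    (contMDiffAt_extChartAt' (n := ∞) (by simpa using h0)).mdifferentiableAt (by simp)
  have h2 : MDifferentiableAt 𝓘(ℝ, E) 𝓘(ℝ, E) (fun k : G => x * k) 1 :=
    (contMDiff_mul_left (I := 𝓘(ℝ, E)) (n := ∞) (a := x)).contMDiffAt.mdifferentiableAt (by simp)
  have h4 := mfderiv_comp (I := 𝓘(ℝ, E)) (I' := 𝓘(ℝ, E)) (I'' := 𝓘(ℝ, E)) (1 : G)
    (f := fun k : G => x * k) h1 h2
  have h5 := congrArg (fun L => L v) h4
  refine h5.trans ?_
  change mfderiv 𝓘(ℝ, E) 𝓘(ℝ, E) (extChartAt 𝓘(ℝ, E) x₀) (x * 1) _ = _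
  rw [mul_one]
  rfl

/-- Near the point, the frame fields are the pullbacks of left-invariant fields under the inverse
chart, and the bracket of left-invariant fields is the left-invariant field of the Lie algebra
bracket. -/
theorem lieBracket_leftFrame [FiniteDimensional ℝ E] (x : G) (v w : E) :
    lieBracket ℝ (fun y => leftFrame x ((extChartAt 𝓘(ℝ, E) x).symm y) v)
      (fun y => leftFrame x ((extChartAt 𝓘(ℝ, E) x).symm y) w) (extChartAt 𝓘(ℝ, E) x x) =
    leftFrame x x (modelBracket G v w) := by
  have := FiniteDimensional.complete ℝ E
  have : LieGroup 𝓘(ℝ, E) (minSmoothness ℝ 3) G :=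
    LieGroup.of_le (m := minSmoothness ℝ 3) (n := ∞) (by simpa using ENat.LEInfty.out)
  have key := congrFun (mulInvariantVector_mlieBracket (I := 𝓘(ℝ, E)) (G := G) v w) x
  have hx := mem_extChartAt_source (I := 𝓘(ℝ, E)) x
  rw [leftFrame_apply x x hx]
  have e : ∀ u : E, (mpullbackWithin 𝓘(ℝ, E) 𝓘(ℝ, E) (extChartAt 𝓘(ℝ, E) x).symm
      (mulInvariantVectorField (I := 𝓘(ℝ, E)) (u : GroupLieAlgebra 𝓘(ℝ, E) G))
      (Set.range 𝓘(ℝ, E)) : E → E)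
      =ᶠ[𝓝 (extChartAt 𝓘(ℝ, E) x x)]
      (fun y => leftFrame x ((extChartAt 𝓘(ℝ, E) x).symm y) u) := by
    intro u
    filter_upwards [(isOpen_extChartAt_target (I := 𝓘(ℝ, E)) x).mem_nhds
      (mem_extChartAt_target x)] with y hy
    rw [leftFrame_apply x _ ((extChartAt 𝓘(ℝ, E) x).map_target hy)]
    have := ContinuousLinearMap.inverse_eq
      (mfderivWithin_extChartAt_symm_comp_mfderiv_extChartAt (I := 𝓘(ℝ, E)) hy)
      (mfderiv_extChartAt_comp_mfderivWithin_extChartAt_symm (I := 𝓘(ℝ, E)) hy)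
    exact congrArg (fun L => L (mulInvariantVectorField (I := 𝓘(ℝ, E))
      (u : GroupLieAlgebra 𝓘(ℝ, E) G) ((extChartAt 𝓘(ℝ, E) x).symm y))) this
  have hb := (e v).symm.lieBracket_vectorField_eq (𝕜 := ℝ) (e w).symm
  refine hb.trans ?_
  change _ = mfderiv 𝓘(ℝ, E) 𝓘(ℝ, E) (extChartAt 𝓘(ℝ, E) x) x
    (mulInvariantVectorField (I := 𝓘(ℝ, E)) (mlieBracket 𝓘(ℝ, E)
    (mulInvariantVectorField (I := 𝓘(ℝ, E)) (v : GroupLieAlgebra 𝓘(ℝ, E) G))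
    (mulInvariantVectorField (I := 𝓘(ℝ, E)) (w : GroupLieAlgebra 𝓘(ℝ, E) G)) 1) x)
  rw [key, ← mlieBracketWithin_univ, mlieBracketWithin_apply]
  have hi := isInvertible_mfderiv_extChartAt (I := 𝓘(ℝ, E)) hx
  -- The manifold bracket carries the coordinate bracket back by the inverse of the chart's
  -- derivative, which cancels against the derivative applied here.
  refine Eq.trans ?_ (hi.self_apply_inverse _).symm
  simp only [modelWithCornersSelf_coe, Set.range_id, Set.preimage_univ, Set.inter_univ]
  exact (congrFun (lieBracketWithin_univ (𝕜 := ℝ) (E := E)) _).symm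

variable (G) in
/-- The Chevalley–Eilenberg differential of a covector. -/
def lieTerm : ∀ {h : ℕ}, Covec E h → (Fin (h + 1) → E) → ℝ
  | 0, _, _ => 0
  | h + 1, ξ, v => -∑ i : Fin (h + 1), ∑ j ≥ i, (-1) ^ (i + j : ℕ) •
      ξ (Matrix.vecCons (modelBracket G (v i.castSucc) (v j.succ))
        (j.removeNth <| i.castSucc.removeNth v))

theorem chartForm_leftFrame {h : ℕ} (α : G → Covec E h) (x : G) {y : E}
    (hy : y ∈ (extChartAt 𝓘(ℝ, E) x).target) (v : Fin h → E) :
    chartForm α x y (fun i => leftFrame x ((extChartAt 𝓘(ℝ, E) x).symm y) (v i)) =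
      α ((extChartAt 𝓘(ℝ, E) x).symm y) v := by
  have i := leftFrame_isInvertible (E := E) x ((extChartAt 𝓘(ℝ, E) x).symm y)
    ((extChartAt 𝓘(ℝ, E) x).map_target hy)
  simp only [chartForm, ContinuousAlternatingMap.compContinuousLinearMap_apply, Function.comp_def,
    i.inverse_apply_self]

/-- Koszul's formula for the exterior derivative, in the left-invariant trivialisation. -/
theorem dFun_apply [FiniteDimensional ℝ E] {h : ℕ} (α : Form E G h) (x : G)
    (v : Fin (h + 1) → E) :
    dFun α x v = (∑ i, (-1) ^ i.val • fderiv ℝ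
      (fun y => α ((extChartAt 𝓘(ℝ, E) x).symm y) (i.removeNth v))
        (extChartAt 𝓘(ℝ, E) x x) (leftFrame x x (v i))) + lieTerm G (α x) v := by
  have hxt := mem_extChartAt_target (I := 𝓘(ℝ, E)) x
  have hop := (isOpen_extChartAt_target (I := 𝓘(ℝ, E)) x).mem_nhds hxt
  have hω := (contDiffAt_chartForm α x hxt).differentiableAt (by simp)
  have hinv : (extChartAt 𝓘(ℝ, E) x).symm (extChartAt 𝓘(ℝ, E) x x) = x := by simp
  set φ := extChartAt 𝓘(ℝ, E) x with hφ
  let V : Fin (h + 1) → E → E := fun i y => leftFrame x (φ.symm y) (v i)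
  have hVx : ∀ i, V i (φ x) = leftFrame x x (v i) := fun i => by simp only [V, hinv]
  have hV : ∀ i, DifferentiableAt ℝ (V i) (φ x) := fun i =>
    (((contDiffOn_leftFrame x).contDiffAt hop).differentiableAt (by simp)).clm_apply
      (differentiableAt_const _)
  have h1 : dFun α x v = extDeriv (chartForm α x) (φ x) (V · (φ x)) := by
    simp only [hVx]; rfl
  have hev : ∀ i : Fin (h + 1), fderiv ℝ (fun y => chartForm α x y (i.removeNth (V · y))) (φ x) =
      fderiv ℝ (fun y => α (φ.symm y) (i.removeNth v)) (φ x) := fun i => by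
    apply Filter.EventuallyEq.fderiv_eq
    filter_upwards [hop] with y hy
    exact chartForm_leftFrame α x hy (i.removeNth v)
  rw [h1]
  cases h with
  | zero =>
    rw [extDeriv_apply hω]
    simp only [lieTerm, add_zero]
    refine Finset.sum_congr rfl fun i _ => ?_
    rw [← hev i, hVx]
    congr 4
    funext y
    congr 1
    exact Subsingleton.elim _ _
  | succ h =>
    -- The vectors are extended by the frame fields `V i`, not by constant fields: the chart form on
    -- them is a coefficient of `α`, and their brackets are frame vectors again.
    rw [extDeriv_apply_vectorField hω hV, sub_eq_add_neg]
    congr 1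
    · refine Finset.sum_congr rfl fun i _ => ?_
      rw [hev i, hVx]
    · simp only [lieTerm]
      congr 1
      refine Finset.sum_congr rfl fun i _ => Finset.sum_congr rfl fun j _ => ?_
      congr 1
      have hb := lieBracket_leftFrame x (v i.castSucc) (v j.succ)
      have h2 := chartForm_leftFrame α x hxt (Matrix.vecCons (modelBracket G (v i.castSucc)
        (v j.succ)) (j.removeNth <| i.castSucc.removeNth v))
      rw [← hφ, hinv] at h2
      rw [← h2]
      congr 1
      funext k
      refine Fin.cases ?_ (fun k => ?_) k
      · exact hb
      · simp [V, Fin.removeNth, hinv]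

theorem covD0_apply [FiniteDimensional ℝ E] {h : ℕ} (ξ : Covec E h) (v : Fin (h + 1) → E) :
    covD0 E G h ξ v = lieTerm G ξ v := by
  refine (dFun_apply ⟨fun _ => ξ, contMDiff_const⟩ (1 : G) v).trans ?_
  refine add_eq_right.2 (Finset.sum_eq_zero fun i _ => ?_)
  change (-1) ^ i.val • fderiv ℝ (fun _ : E => ξ (i.removeNth v)) _ _ = 0
  simp

/-- Koszul's formula, with the action of `d` on left-invariant forms as the term of order zero. -/
theorem deRham_apply [FiniteDimensional ℝ E] {h : ℕ} (α : Form E G h) (x : G)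
    (v : Fin (h + 1) → E) :
    deRham (E := E) (G := G) h α x v = (∑ i, (-1) ^ i.val • fderiv ℝ
      (fun y => α ((extChartAt 𝓘(ℝ, E) x).symm y) (i.removeNth v))
        (extChartAt 𝓘(ℝ, E) x x) (leftFrame x x (v i))) + covD0 E G h (α x) v := by
  rw [covD0_apply]
  exact dFun_apply α x v

end MaurerCartan

/-! ### Weight components of covectors -/

section CovectorWeights
variable {E : Type*} [NormedAddCommGroup E] [NormedSpace ℝ E] {n : ℕ}

theorem mem_incr {h n : ℕ} {J : Fin h → Fin n} : J ∈ incr h n ↔ StrictMono J := by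
  simp [incr]

theorem eq_of_incr (b : Module.Basis (Fin n) ℝ E) {h : ℕ} {ξ η : Covec E h}
    (H : ∀ J ∈ incr h n, ξ (fun i => b (J i)) = η (fun i => b (J i))) : ξ = η := by
  rw [← sub_eq_zero]
  refine eq_zero_of_incr b _ fun J hJ => ?_
  simp [H J hJ]

/-- A covector that vanishes on the increasing tuples of basis vectors of weight `t` vanishes on
all tuples of basis vectors of weight `t`. -/
theorem vanish_of_incr (b : Module.Basis (Fin n) ℝ E) (w : Fin n → ℕ) {h : ℕ} {ξ : Covec E h}
    {t : ℤ} (hξ : ∀ J ∈ incr h n, ∑ i, (w (J i) : ℤ) = t → ξ (fun i => b (J i)) = 0)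
    (J : Fin h → Fin n) (ht : ∑ i, (w (J i) : ℤ) = t) : ξ (fun i => b (J i)) = 0 := by
  by_cases hJ : Function.Injective J
  · have hs : StrictMono (J ∘ Tuple.sort J) :=
      (Tuple.monotone_sort J).strictMono_of_injective (hJ.comp (Tuple.sort J).injective)
    have h0 := hξ (J ∘ Tuple.sort J) (mem_incr.2 hs)
      ((Equiv.sum_comp (Tuple.sort J) fun i => (w (J i) : ℤ)).trans ht)
    have h1 := ξ.toAlternatingMap.map_perm (fun i => b (J i)) (Tuple.sort J)
    have h2 : ξ.toAlternatingMap ((fun i => b (J i)) ∘ Tuple.sort J) = 0 := h0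
    rw [h2] at h1
    rcases Int.units_eq_one_or (Equiv.Perm.sign (Tuple.sort J)) with hu | hu
    · rw [hu] at h1
      simpa using h1.symm
    · rw [hu] at h1
      simpa using h1.symm
  · obtain ⟨i, j, hij, hne⟩ : ∃ i j, J i = J j ∧ i ≠ j := by
      simpa [Function.Injective] using hJ
    exact ξ.map_eq_zero_of_eq _ (by simp [hij]) hne

theorem covInner_apply (b : Module.Basis (Fin n) ℝ E) {h : ℕ} (ξ η : Covec E h) :
    covInner b h ξ η = ∑ J ∈ incr h n, ξ (fun i => b (J i)) * η (fun i => b (J i)) := rfl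

theorem eq_zero_of_covInner_self (b : Module.Basis (Fin n) ℝ E) {h : ℕ} {ξ : Covec E h}
    (hξ : covInner b h ξ ξ = 0) : ξ = 0 := by
  rw [covInner_apply, Finset.sum_eq_zero_iff_of_nonneg (fun _ _ => mul_self_nonneg _)] at hξ
  exact eq_zero_of_incr b ξ fun J hJ => mul_self_eq_zero.1 (hξ J hJ)

theorem covInner_comm (b : Module.Basis (Fin n) ℝ E) {h : ℕ} (ξ η : Covec E h) :
    covInner b h ξ η = covInner b h η ξ := by
  simp [covInner_apply, mul_comm]

variable [FiniteDimensional ℝ E]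

/-- Distinct increasing tuples of equal length have distinct ranges, so some entry of `K` is missing
from `J` and gives the determinant a zero row. -/
theorem wedge_apply_incr (b : Module.Basis (Fin n) ℝ E) {h : ℕ} {J K : Fin h → Fin n}
    (hJ : J ∈ incr h n) (hK : K ∈ incr h n) :
    wedge b J (fun i => b (K i)) = if J = K then 1 else 0 := by
  rw [mem_incr] at hJ hK
  have e : wedge b J (fun i => b (K i)) =
      Matrix.det (Matrix.of fun i j => if K i = J j then (1 : ℝ) else 0) := by
    change Matrix.det (Matrix.of fun i j => b.coord (J j) (b (K i))) = _
    simp [Finsupp.single_apply]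
  rw [e]
  split_ifs with hJK
  · subst hJK
    rw [← Matrix.det_one (n := Fin h)]
    congr 1
    ext i j
    simp [Matrix.one_apply, hJ.injective.eq_iff]
  · obtain ⟨i, hi⟩ : ∃ i, ∀ j, K i ≠ J j := by
      by_contra! hc
      apply hJK
      have hsub : Set.range K ⊆ Set.range J := by
        rintro _ ⟨i, rfl⟩
        obtain ⟨j, hj⟩ := hc i
        exact ⟨j, hj.symm⟩
      refine (hJ.range_inj hK).1 (Set.eq_of_subset_of_ncard_le hsub ?_ (Set.toFinite _)).symm
      rw [← Set.image_univ, ← Set.image_univ, Set.ncard_image_of_injective _ hJ.injective,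
        Set.ncard_image_of_injective _ hK.injective]
    exact Matrix.det_eq_zero_of_row_eq_zero i fun j => by simp [hi j]

theorem covProj_apply_incr (b : Module.Basis (Fin n) ℝ E) (w : Fin n → ℕ) {h : ℕ} (a : ℤ)
    (ξ : Covec E h) {K : Fin h → Fin n} (hK : K ∈ incr h n) :
    covProj b w h a ξ (fun i => b (K i)) =
      if ∑ i, (w (K i) : ℤ) = a then ξ (fun i => b (K i)) else 0 := by
  have e : covProj b w h a ξ (fun i => b (K i)) =
      ∑ J ∈ (incr h n).filter (fun J => ∑ i, (w (J i) : ℤ) = a),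
        ξ (fun i => b (J i)) * wedge b J (fun i => b (K i)) := by
    change (∑ J ∈ (incr h n).filter (fun J => ∑ i, (w (J i) : ℤ) = a),
      ξ (fun i => b (J i)) • wedge b J) (fun i => b (K i)) = _
    rw [ContinuousAlternatingMap.sum_apply]
    rfl
  rw [e]
  have e2 : ∀ J ∈ (incr h n).filter (fun J => ∑ i, (w (J i) : ℤ) = a),
      ξ (fun i => b (J i)) * wedge b J (fun i => b (K i)) =
        if J = K then ξ (fun i => b (J i)) else 0 := fun J hJ => by
    rw [wedge_apply_incr b (Finset.mem_filter.1 hJ).1 hK]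
    simp
  rw [Finset.sum_congr rfl e2, Finset.sum_ite_eq']
  simp [hK]

/-- Total weight ignores the order of the indices, so antisymmetry extends the formula beyond
increasing tuples. The bracket term of Koszul's formula produces unsorted ones. -/
theorem covProj_apply (b : Module.Basis (Fin n) ℝ E) (w : Fin n → ℕ) {h : ℕ} (a : ℤ)
    (ξ : Covec E h) (K : Fin h → Fin n) :
    covProj b w h a ξ (fun i => b (K i)) =
      if ∑ i, (w (K i) : ℤ) = a then ξ (fun i => b (K i)) else 0 := by
  split_ifs with ha
  · have := vanish_of_incr b w (ξ := covProj b w h a ξ - ξ) (t := a) (fun J hJ hJa => by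
      simp [covProj_apply_incr b w a ξ hJ, hJa]) K ha
    exact sub_eq_zero.1 this
  · refine vanish_of_incr b w (t := ∑ i, (w (K i) : ℤ)) (fun J hJ hJa => ?_) K rfl
    rw [covProj_apply_incr b w a ξ hJ, hJa, if_neg ha]

theorem covProj_covProj (b : Module.Basis (Fin n) ℝ E) (w : Fin n → ℕ) {h : ℕ} (a c : ℤ)
    (ξ : Covec E h) :
    covProj b w h a (covProj b w h c ξ) = if a = c then covProj b w h a ξ else 0 := by
  refine eq_of_incr b fun K _ => ?_
  by_cases hac : a = c
  · subst hac
    simp only [covProj_apply, if_true]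
    split_ifs <;> rfl
  · simp only [covProj_apply, if_neg hac]
    split_ifs with h1 h2
    · exact absurd (h1.symm.trans h2) hac
    · rfl
    · rfl

theorem sum_weight_le (w : Fin n → ℕ) {h : ℕ} {K : Fin h → Fin n} (hK : K ∈ incr h n) :
    ∑ i, w (K i) ≤ ∑ i, w i := by
  rw [← Finset.sum_image (s := Finset.univ) (g := K) (f := w)
    ((mem_incr.1 hK).injective.injOn)]
  exact Finset.sum_le_sum_of_subset (Finset.subset_univ _)

theorem covProj_eq_zero (b : Module.Basis (Fin n) ℝ E) (w : Fin n → ℕ) {h : ℕ} {a : ℤ}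
    (ha : a < 0 ∨ ((∑ i, w i : ℕ) : ℤ) < a) (ξ : Covec E h) : covProj b w h a ξ = 0 := by
  refine eq_zero_of_incr b _ fun K hK => ?_
  rw [covProj_apply, if_neg]
  have := sum_weight_le w hK
  rw [← Nat.cast_sum]
  omega

theorem sum_covProj (b : Module.Basis (Fin n) ℝ E) (w : Fin n → ℕ) {h : ℕ} (ξ : Covec E h) :
    ∑ a ∈ Finset.range ((∑ i, w i) + 1), covProj b w h a ξ = ξ := by
  refine eq_of_incr b fun K hK => ?_
  rw [ContinuousAlternatingMap.sum_apply]
  simp only [covProj_apply, ← Nat.cast_sum, Nat.cast_inj]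
  rw [Finset.sum_ite_eq, if_pos]
  have := sum_weight_le w hK
  simp; omega

/-- The orthonormal basis consists of covectors of pure weight. Self-adjointness is what lets
`partialInverse` commute with weight projections. -/
theorem covInner_covProj (b : Module.Basis (Fin n) ℝ E) (w : Fin n → ℕ) {h : ℕ} (a : ℤ)
    (ξ η : Covec E h) :
    covInner b h ξ (covProj b w h a η) = covInner b h (covProj b w h a ξ) η := by
  simp only [covInner_apply, covProj_apply]
  refine Finset.sum_congr rfl fun J _ => ?_
  split_ifs <;> simp

end CovectorWeights

/-! ### The inverse of a linear map relative to inner products -/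

section PartialInverse
variable {E : Type*} [NormedAddCommGroup E] [NormedSpace ℝ E] [FiniteDimensional ℝ E] {n : ℕ}
  (b : Module.Basis (Fin n) ℝ E) {h k : ℕ} (f : Covec E h →ₗ[ℝ] Covec E k)

theorem covInner_partialInverse (β : Covec E k) {κ : Covec E h} (hκ : f κ = 0) :
    covInner b h κ (partialInverse b f β) = 0 := by
  have : partialInverse b f β ∈ (covInner b h).orthogonal (LinearMap.ker f) := by
    simp [partialInverse]
  exact this κ hκ

/-- By construction `f (partialInverse b f β)` is the orthogonal projection `ρ` of `β` onto the
range, so the residue projects to zero. -/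
theorem covInner_map_partialInverse_sub (β : Covec E k) (κ : Covec E h) :
    covInner b k (f κ) (f (partialInverse b f β) - β) = 0 := by
  set C := isCompl_orthogonal b k (LinearMap.range f)
  set ρ := Submodule.projectionOnto _ _ C β with hρ
  set q := f.quotKerEquivRange.symm ρ with hq
  have h1 : f (partialInverse b f β) = ρ := by
    have h2 : partialInverse b f β =
      (Submodule.quotientEquivOfIsCompl _ _ (isCompl_orthogonal b h (LinearMap.ker f)) q : _) := rfl
    have h3 : (LinearMap.ker f).mkQ (partialInverse b f β) = q := by
      rw [h2]
      exact Submodule.mk_quotientEquivOfIsCompl_apply _ _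
    have h4 : f.quotKerEquivRange ((LinearMap.ker f).mkQ (partialInverse b f β)) = ρ := by
      rw [h3, hq, LinearEquiv.apply_symm_apply]
    exact congrArg Subtype.val h4
  have h5 : (ρ : Covec E k) - β ∈ (covInner b k).orthogonal (LinearMap.range f) := by
    rw [← Submodule.projectionOnto_apply_eq_zero_iff C, map_sub, Submodule.projectionOnto_apply_left,
      sub_self]
  rw [h1]
  exact h5 (f κ) ⟨κ, rfl⟩

/-- Positivity is used twice: the two images differ by a vector both in the range and orthogonal to
it; then the two solutions differ by a vector both in the kernel and orthogonal to it. -/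
theorem eq_partialInverse {α : Covec E h} {β : Covec E k}
    (h1 : ∀ κ, f κ = 0 → covInner b h κ α = 0)
    (h2 : ∀ κ, covInner b k (f κ) (f α - β) = 0) : α = partialInverse b f β := by
  have h3 : f (α - partialInverse b f β) = 0 := by
    refine eq_zero_of_covInner_self b ?_
    have e : f (α - partialInverse b f β) = (f α - β) - (f (partialInverse b f β) - β) := by
      rw [map_sub]; abel
    nth_rewrite 2 [e]
    rw [LinearMap.map_sub, h2, covInner_map_partialInverse_sub, sub_zero]
  rw [← sub_eq_zero]
  refine eq_zero_of_covInner_self b ?_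
  rw [LinearMap.map_sub, h1 _ h3, covInner_partialInverse b f β h3, sub_zero]

theorem map_partialInverse_map (α : Covec E h) : f (partialInverse b f (f α)) = f α := by
  rw [← sub_eq_zero]
  refine eq_zero_of_covInner_self b ?_
  rw [← map_sub]
  nth_rewrite 2 [map_sub]
  exact covInner_map_partialInverse_sub b f _ _

theorem partialInverse_map_partialInverse (β : Covec E k) :
    partialInverse b f (f (partialInverse b f β)) = partialInverse b f β :=
  (eq_partialInverse b f (fun _ hκ => covInner_partialInverse b f β hκ)
    (fun κ => by rw [sub_self, map_zero])).symm

theorem partialInverse_eq_zero {β : Covec E k} (hβ : ∀ κ, covInner b k (f κ) β = 0) :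
    partialInverse b f β = 0 :=
  (eq_partialInverse b f (fun _ _ => map_zero _)
    (fun κ => by rw [map_zero, zero_sub, map_neg, hβ, neg_zero])).symm

theorem covInner_map_eq_zero {β : Covec E k} (hβ : partialInverse b f β = 0) (κ : Covec E h) :
    covInner b k (f κ) β = 0 := by
  have := covInner_map_partialInverse_sub b f β κ
  rwa [hβ, map_zero, zero_sub, map_neg, neg_eq_zero] at this

/-- Since `im f ⊆ ker g`, the range `(ker g)^⊥` of the inner inverse lies in `(im f)^⊥`, where the
outer one vanishes. -/
theorem partialInverse_partialInverse {l : ℕ} (g : Covec E k →ₗ[ℝ] Covec E l)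
    (hgf : ∀ κ, g (f κ) = 0) (β : Covec E l) :
    partialInverse b f (partialInverse b g β) = 0 :=
  partialInverse_eq_zero b f fun κ => covInner_partialInverse b g β (hgf κ)

/-- A self-adjoint projection commuting with `f` carries the solution for `β` to one for the
projected `β`; uniqueness does the rest. -/
theorem partialInverse_covProj (w : Fin n → ℕ) (a : ℤ)
    (hf : ∀ κ, f (covProj b w h a κ) = covProj b w k a (f κ)) (β : Covec E k) :
    partialInverse b f (covProj b w k a β) = covProj b w h a (partialInverse b f β) := by
  refine (eq_partialInverse b f (fun κ hκ => ?_) fun κ => ?_).symm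
  · rw [covInner_covProj]
    refine covInner_partialInverse b f β ?_
    rw [hf, hκ, map_zero]
  · rw [hf, ← map_sub, covInner_covProj, ← hf]
    exact covInner_map_partialInverse_sub b f β _

end PartialInverse

/-! ### The operators `d_0` and `d_0⁻¹` on forms, and their weights -/

section Operators
variable {E : Type*} [NormedAddCommGroup E] [NormedSpace ℝ E]
  {G : Type*} [TopologicalSpace G] [ChartedSpace E G]

/-- The value at `x` of the component of degree `h` of a form. -/
def Forms.evalAt (h : ℕ) (x : G) : Forms E G →ₗ[ℝ] Covec E h where
  toFun α := α h x
  map_add' _ _ := rfl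
  map_smul' _ _ := rfl

theorem Forms.ext_evalAt {α β : Forms E G}
    (H : ∀ h x, Forms.evalAt h x α = Forms.evalAt h x β) : α = β := by
  funext h
  ext1 x
  exact H h x

variable [FiniteDimensional ℝ E] [Group G] [LieGroup 𝓘(ℝ, E) ∞ G]

theorem deRham_const {h : ℕ} (ξ : Covec E h) :
    deRham (E := E) (G := G) h ⟨fun _ => ξ, contMDiff_const⟩ =
      ⟨fun _ => covD0 E G h ξ, contMDiff_const⟩ := by
  ext1 x
  ext v
  refine (deRham_apply _ x v).trans ?_
  refine add_eq_right.2 (Finset.sum_eq_zero fun i _ => ?_)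
  change (-1) ^ i.val • fderiv ℝ (fun _ : E => ξ (i.removeNth v)) _ _ = 0
  simp

theorem covD0_covD0 {h : ℕ} (ξ : Covec E h) : covD0 E G (h + 1) (covD0 E G h ξ) = 0 := by
  have h1 := deRham_deRham (E := E) (G := G) (h := h) ⟨fun _ => ξ, contMDiff_const⟩
  rw [deRham_const] at h1
  exact congrArg (fun β : Form E G (h + 1 + 1) => β 1) h1

namespace AdaptedBasis
variable {S : Stratification E G} {n : ℕ} (A : AdaptedBasis S n)

/-- This positivity is why each derivative in Koszul's formula strictly raises the weight. -/
theorem weight_pos (i : Fin n) : 1 ≤ A.weight i := by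
  by_contra hc
  have h0 : A.weight i = 0 := by omega
  have h1 := A.mem_layer i
  rw [h0, S.layer_zero, Submodule.mem_bot] at h1
  exact A.basis.ne_zero i h1

/-- The part `z` of the expansion with weights other than `m` lies both in layer `m` and in the sum
of the other layers, so it vanishes because the sum is direct. -/
theorem repr_eq_zero_of_mem_layer {m : ℕ} {x : GroupLieAlgebra 𝓘(ℝ, E) G} (hx : x ∈ S.layer m)
    {k : Fin n} (hk : A.weight k ≠ m) : A.basis.repr x k = 0 := by
  classical
  have hsum := A.basis.sum_repr x
  rw [← Finset.sum_filter_add_sum_filter_not Finset.univ (fun k => A.weight k = m)] at hsum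
  set y := ∑ k with A.weight k = m, A.basis.repr x k • A.basis k with hy
  set z := ∑ k with ¬ A.weight k = m, A.basis.repr x k • A.basis k with hz
  have hym : y ∈ S.layer m := Submodule.sum_mem _ fun k hk => by
    have := A.mem_layer k
    rw [(Finset.mem_filter.1 hk).2] at this
    exact Submodule.smul_mem _ _ this
  have hzm : z ∈ ⨆ j, ⨆ (_ : j ≠ m), S.layer j := Submodule.sum_mem _ fun k hk =>
    Submodule.smul_mem _ _ (Submodule.mem_iSup_of_mem (A.weight k)
      (Submodule.mem_iSup_of_mem (Finset.mem_filter.1 hk).2 (A.mem_layer k)))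
  have hz1 : z ∈ S.layer m := by
    have : z = x - y := by rw [← hsum]; abel
    rw [this]
    exact Submodule.sub_mem _ hx hym
  have hz0 : z = 0 := Submodule.disjoint_def.1 (S.isInternal.submodule_iSupIndep m) z hz1 hzm
  have hl := linearIndependent_iff'.1 A.basis.linearIndependent _ _ hz0
  exact hl k (by simpa using hk)

theorem modelBracket_frame (i j : Fin n) :
    modelBracket G (A.frame i) (A.frame j) =
      ∑ k with A.weight k = A.weight i + A.weight j,
        A.frame.repr (modelBracket G (A.frame i) (A.frame j)) k • A.frame k := by
  have hx : Membership.mem (γ := Submodule ℝ (GroupLieAlgebra 𝓘(ℝ, E) G))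
      (S.layer (A.weight i + A.weight j)) (modelBracket G (A.frame i) (A.frame j)) :=
    S.bracket_mem _ _ _ _ (A.mem_layer i) (A.mem_layer j)
  rw [Finset.sum_filter_of_ne, A.frame.sum_repr]
  intro k _ hk
  by_contra hc
  have h0 : A.frame.repr (modelBracket G (A.frame i) (A.frame j)) k = 0 :=
    A.repr_eq_zero_of_mem_layer hx hc
  exact hk (by rw [h0, zero_smul])

/-- The differential of left-invariant forms does not change the weight. -/
theorem covD0_vanish {h : ℕ} {ξ : Covec E h} {t : ℤ}
    (hξ : ∀ K : Fin h → Fin n, ∑ i, (A.weight (K i) : ℤ) = t → ξ (fun i => A.frame (K i)) = 0)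
    (K : Fin (h + 1) → Fin n) (hK : ∑ i, (A.weight (K i) : ℤ) = t) :
    covD0 E G h ξ (fun i => A.frame (K i)) = 0 := by
  rw [covD0_apply]
  cases h with
  | zero => rfl
  | succ h =>
    rw [lieTerm, neg_eq_zero]
    refine Finset.sum_eq_zero fun i _ => Finset.sum_eq_zero fun j hj => ?_
    rw [A.modelBracket_frame]
    have e : ∀ (y : E) (u : Fin h → E), ξ (Matrix.vecCons y u) = ξ.curryLeft y u :=
      fun _ _ => rfl
    rw [e, map_sum, ContinuousAlternatingMap.sum_apply, Finset.sum_eq_zero, smul_zero]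
    intro k hk
    rw [map_smul, ContinuousAlternatingMap.smul_apply, ← e]
    have h1 : Matrix.vecCons (A.frame k) (j.removeNth (i.castSucc.removeNth
        fun i => A.frame (K i))) = fun l => A.frame (Matrix.vecCons k
        (j.removeNth (i.castSucc.removeNth K)) l) := by
      funext l
      refine Fin.cases rfl (fun l => rfl) l
    rw [h1, hξ, smul_zero]
    -- Two vectors are replaced by a basis vector of weight equal to the sum of theirs, so the total
    -- weight is still `t`. As `j ≥ i`, the second removed index is `j.succ` in the original tuple.
    rw [Fin.sum_univ_succ]
    rw [Fin.sum_univ_succAbove _ i.castSucc, Fin.sum_univ_succAbove _ j] at hK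
    simp only [Fin.removeNth, Matrix.cons_val_zero, Matrix.cons_val_succ,
      (Finset.mem_filter.1 hk).2]
    have hs : i.castSucc.succAbove j = j.succ :=
      Fin.succAbove_of_le_castSucc _ _ (Fin.castSucc_le_castSucc_iff.2 (Finset.mem_Ici.1 hj))
    rw [← hK, hs]
    push_cast
    ring

theorem covD0_covProj {h : ℕ} (a : ℤ) (ξ : Covec E h) :
    covD0 E G h (covProj A.frame A.weight h a ξ) =
      covProj A.frame A.weight (h + 1) a (covD0 E G h ξ) := by
  refine eq_of_incr A.frame fun K _ => ?_
  rw [covProj_apply]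
  split_ifs with hK
  · rw [← sub_eq_zero]
    have := A.covD0_vanish (ξ := covProj A.frame A.weight h a ξ - ξ) (t := a) (fun J hJ => by
      simp [covProj_apply, hJ]) K hK
    rwa [map_sub] at this
  · exact A.covD0_vanish (fun J hJ => by rw [covProj_apply, hJ, if_neg hK]) K rfl

theorem evalAt_wproj (a : ℤ) (α : Forms E G) (h : ℕ) (x : G) :
    Forms.evalAt h x (A.wproj a α) = covProj A.frame A.weight h a (Forms.evalAt h x α) := rfl

theorem evalAt_d_succ (α : Forms E G) (h : ℕ) (x : G) :
    Forms.evalAt (h + 1) x (d E G α) = deRham (E := E) (G := G) h (α h) x := rfl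

theorem evalAt_d_zero (α : Forms E G) (x : G) : Forms.evalAt 0 x (d E G α) = 0 := rfl

theorem evalAt_d0inv (α : Forms E G) (h : ℕ) (x : G) :
    Forms.evalAt h x (A.d0inv α) =
      partialInverse A.frame (covD0 E G h) (Forms.evalAt (h + 1) x α) := rfl

theorem wproj_wproj (a c : ℤ) (α : Forms E G) :
    A.wproj a (A.wproj c α) = if a = c then A.wproj a α else 0 := by
  refine Forms.ext_evalAt fun h x => ?_
  rw [evalAt_wproj, evalAt_wproj, covProj_covProj]
  split_ifs
  · rfl
  · rfl

theorem wproj_eq_zero {a : ℤ} (ha : a < 0 ∨ (A.homDim : ℤ) < a) (α : Forms E G) :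
    A.wproj a α = 0 := by
  refine Forms.ext_evalAt fun h x => ?_
  rw [evalAt_wproj, covProj_eq_zero _ _ ha, map_zero]

theorem sum_wproj (α : Forms E G) : ∑ a ∈ Finset.range (A.homDim + 1), A.wproj a α = α := by
  refine Forms.ext_evalAt fun h x => ?_
  rw [map_sum]
  exact sum_covProj A.frame A.weight _

/-- Removing an entry of `K` leaves total weight below `a`, where the coefficients of a form of
weight `a` vanish identically. Only the algebraic term survives. -/
theorem evalAt_d_wproj {h : ℕ} {a : ℤ} (α : Forms E G) (x : G) (K : Fin (h + 1) → Fin n)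
    (hK : ∑ i, (A.weight (K i) : ℤ) ≤ a) :
    Forms.evalAt (h + 1) x (d E G (A.wproj a α)) (fun i => A.frame (K i)) =
      covD0 E G h (Forms.evalAt h x (A.wproj a α)) (fun i => A.frame (K i)) := by
  rw [evalAt_d_succ, deRham_apply]
  refine add_eq_right.2 (Finset.sum_eq_zero fun i _ => ?_)
  have e : ∀ y, (A.wproj a α h) y (i.removeNth fun i => A.frame (K i)) = 0 := fun y => by
    refine (covProj_apply A.frame A.weight a (α h y) (i.removeNth K)).trans (if_neg ?_)
    rw [Fin.sum_univ_succAbove _ i] at hK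
    have := A.weight_pos (K i)
    simp only [Fin.removeNth]
    omega
  simp only [e]
  simp

theorem wproj_d_wproj_of_lt {a c : ℤ} (hc : c < a) (α : Forms E G) :
    A.wproj c (d E G (A.wproj a α)) = 0 := by
  refine Forms.ext_evalAt fun h x => ?_
  cases h with
  | zero => rw [evalAt_wproj, evalAt_d_zero, map_zero, map_zero]
  | succ h =>
    rw [map_zero, evalAt_wproj]
    refine eq_zero_of_incr A.frame _ fun K _ => ?_
    rw [covProj_apply]
    split_ifs with hK
    · rw [A.evalAt_d_wproj α x K (by omega), evalAt_wproj, covD0_covProj, covProj_apply,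
        if_neg (by omega)]
    · rfl

theorem evalAt_wproj_d_wproj (a : ℤ) (α : Forms E G) (h : ℕ) (x : G) :
    Forms.evalAt (h + 1) x (A.wproj a (d E G (A.wproj a α))) =
      covD0 E G h (Forms.evalAt h x (A.wproj a α)) := by
  refine eq_of_incr A.frame fun K _ => ?_
  rw [evalAt_wproj, covProj_apply]
  split_ifs with hK
  · rw [A.evalAt_d_wproj α x K hK.le]
  · rw [evalAt_wproj, covD0_covProj, covProj_apply, if_neg hK]

/-- `d_0` acts pointwise, by the differential of left-invariant forms. -/
theorem evalAt_dW_zero (α : Forms E G) (h : ℕ) (x : G) :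
    Forms.evalAt (h + 1) x (A.dW 0 α) = covD0 E G h (Forms.evalAt h x α) := by
  conv_rhs => rw [← A.sum_wproj α, map_sum, map_sum]
  rw [dW, LinearMap.sum_apply, map_sum]
  refine Finset.sum_congr rfl fun a _ => ?_
  rw [← evalAt_wproj_d_wproj]
  simp

theorem evalAt_dW_zero_zero (α : Forms E G) (x : G) : Forms.evalAt 0 x (A.dW 0 α) = 0 := by
  rw [dW, LinearMap.sum_apply, map_sum]
  refine Finset.sum_eq_zero fun a _ => ?_
  rw [Module.End.mul_apply, Module.End.mul_apply, evalAt_wproj, evalAt_d_zero, map_zero]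

theorem dW_zero_dW_zero (α : Forms E G) : A.dW 0 (A.dW 0 α) = 0 := by
  refine Forms.ext_evalAt fun h x => ?_
  match h with
  | 0 => rw [evalAt_dW_zero_zero, map_zero]
  | 1 => rw [evalAt_dW_zero, evalAt_dW_zero_zero, map_zero, map_zero]
  | h + 2 => rw [evalAt_dW_zero, evalAt_dW_zero, covD0_covD0, map_zero]

theorem d0inv_d0inv (α : Forms E G) : A.d0inv (A.d0inv α) = 0 := by
  refine Forms.ext_evalAt fun h x => ?_
  rw [evalAt_d0inv, evalAt_d0inv, partialInverse_partialInverse _ _ _ covD0_covD0, map_zero]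

theorem dW_zero_d0inv_dW_zero (α : Forms E G) : A.dW 0 (A.d0inv (A.dW 0 α)) = A.dW 0 α := by
  refine Forms.ext_evalAt fun h x => ?_
  cases h with
  | zero => rw [evalAt_dW_zero_zero, evalAt_dW_zero_zero]
  | succ h => rw [evalAt_dW_zero, evalAt_d0inv, evalAt_dW_zero, map_partialInverse_map]

theorem d0inv_dW_zero_d0inv (α : Forms E G) : A.d0inv (A.dW 0 (A.d0inv α)) = A.d0inv α := by
  refine Forms.ext_evalAt fun h x => ?_
  rw [evalAt_d0inv, evalAt_dW_zero, evalAt_d0inv, partialInverse_map_partialInverse]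

theorem wproj_d0inv (a : ℤ) (α : Forms E G) : A.wproj a (A.d0inv α) = A.d0inv (A.wproj a α) := by
  refine Forms.ext_evalAt fun h x => ?_
  rw [evalAt_wproj, evalAt_d0inv, evalAt_d0inv, evalAt_wproj,
    partialInverse_covProj _ _ _ _ (A.covD0_covProj a)]

/-- Orthogonality is required only against smooth `d_0 β`. The choice `β = d_0⁻¹ α` is enough, since
`d_0 d_0⁻¹ α` is the pointwise projection of `α` onto `im d_0`. -/
theorem mem_ruminForms {α : Forms E G} :
    α ∈ A.ruminForms ↔ A.dW 0 α = 0 ∧ A.d0inv α = 0 := by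
  refine and_congr_right fun _ => ⟨fun H => ?_, fun H β h x => ?_⟩
  · have e : A.dW 0 (A.d0inv α) = 0 := by
      refine Forms.ext_evalAt fun h x => ?_
      rw [map_zero]
      refine eq_zero_of_covInner_self A.frame ?_
      have h1 : covInner A.frame h (Forms.evalAt h x (A.dW 0 (A.d0inv α)))
          (Forms.evalAt h x (A.dW 0 (A.d0inv α)) - Forms.evalAt h x α) = 0 := by
        cases h with
        | zero => rw [evalAt_dW_zero_zero, LinearMap.map_zero₂]
        | succ h =>
          rw [evalAt_dW_zero, evalAt_d0inv]
          exact covInner_map_partialInverse_sub _ _ _ _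
      rw [map_sub, sub_eq_zero] at h1
      rw [h1, covInner_comm]
      exact H (A.d0inv α) h x
    rw [← A.d0inv_dW_zero_d0inv, e, map_zero]
  · change covInner A.frame h (Forms.evalAt h x α) (Forms.evalAt h x (A.dW 0 β)) = 0
    rw [covInner_comm]
    cases h with
    | zero => rw [evalAt_dW_zero_zero, LinearMap.map_zero₂]
    | succ h =>
      rw [evalAt_dW_zero]
      refine covInner_map_eq_zero _ _ ?_ _
      rw [← evalAt_d0inv, H, map_zero]

theorem ortho_d0inv (β : Forms E G) {κ : Forms E G} (hκ : A.dW 0 κ = 0) :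
    A.Ortho (A.d0inv β) κ := by
  intro h x
  change covInner A.frame h (Forms.evalAt h x (A.d0inv β)) (Forms.evalAt h x κ) = 0
  rw [covInner_comm, evalAt_d0inv]
  refine covInner_partialInverse _ _ _ ?_
  rw [← A.evalAt_dW_zero, hκ, map_zero]

/-- The difference `κ` of the two sides is itself a smooth form in `ker d_0`, and both sides are
orthogonal to it. -/
theorem d0inv_dW_zero_of_ortho {z : Forms E G} (hz : ∀ κ, A.dW 0 κ = 0 → A.Ortho z κ) :
    A.d0inv (A.dW 0 z) = z := by
  set κ := A.d0inv (A.dW 0 z) - z with hκ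
  have h0 : A.dW 0 κ = 0 := by rw [hκ, map_sub, dW_zero_d0inv_dW_zero, sub_self]
  rw [← sub_eq_zero, ← hκ]
  refine Forms.ext_evalAt fun h x => ?_
  rw [map_zero]
  refine eq_zero_of_covInner_self A.frame ?_
  have h1 : covInner A.frame h (Forms.evalAt h x (A.d0inv (A.dW 0 z))) (Forms.evalAt h x κ) = 0 :=
    A.ortho_d0inv _ h0 h x
  have h2 : covInner A.frame h (Forms.evalAt h x z) (Forms.evalAt h x κ) = 0 := hz κ h0 h x
  have h3 : Forms.evalAt h x κ =
    Forms.evalAt h x (A.d0inv (A.dW 0 z)) - Forms.evalAt h x z := map_sub _ _ _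
  nth_rewrite 1 [h3]
  rw [LinearMap.map_sub₂, h1, h2, sub_zero]

end AdaptedBasis
end Operators

/-! ### The filtration by weights, `P`, `Π_E` and `d_c` -/

section RuminComplex
variable {E : Type*} [NormedAddCommGroup E] [NormedSpace ℝ E]
  {G : Type*} [TopologicalSpace G] [ChartedSpace E G]
  [FiniteDimensional ℝ E] [Group G] [LieGroup 𝓘(ℝ, E) ∞ G]

namespace AdaptedBasis
variable {S : Stratification E G} {n : ℕ} (A : AdaptedBasis S n)

theorem mem_weightForms {a : ℤ} {x : Forms E G} : x ∈ A.weightForms a ↔ A.wproj a x = x := by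
  refine ⟨?_, fun H => ⟨x, H⟩⟩
  rintro ⟨y, rfl⟩
  rw [wproj_wproj, if_pos rfl]

theorem wproj_mem_weightForms (a : ℤ) (x : Forms E G) : A.wproj a x ∈ A.weightForms a := ⟨x, rfl⟩

theorem wproj_of_mem_weightForms {a c : ℤ} {x : Forms E G} (hx : x ∈ A.weightForms a) :
    A.wproj c x = if c = a then x else 0 := by
  rw [← A.mem_weightForms.1 hx, wproj_wproj]
  split_ifs with h
  · rw [h]
  · rfl

theorem mem_filtration {p : ℤ} {x : Forms E G} :
    x ∈ A.filtration p ↔ ∀ a < p, A.wproj a x = 0 := by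
  simp [filtration, Submodule.mem_iInf]

theorem filtration_anti {p q : ℤ} (hpq : p ≤ q) : A.filtration q ≤ A.filtration p := fun _ hx =>
  A.mem_filtration.2 fun a ha => A.mem_filtration.1 hx a (by omega)

theorem weightForms_le_filtration {p a : ℤ} (h : p ≤ a) : A.weightForms a ≤ A.filtration p :=
  fun _ hx => A.mem_filtration.2 fun c hc => by
    rw [A.wproj_of_mem_weightForms hx, if_neg (by omega)]

theorem mem_filtration_zero (x : Forms E G) : x ∈ A.filtration 0 :=
  A.mem_filtration.2 fun _ ha => A.wproj_eq_zero (Or.inl ha) x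

theorem ext_wproj {x y : Forms E G} (H : ∀ a, A.wproj a x = A.wproj a y) : x = y := by
  rw [← A.sum_wproj x, ← A.sum_wproj y]
  exact Finset.sum_congr rfl fun a _ => H a

theorem eq_zero_of_mem_filtration {p : ℤ} (hp : (A.homDim : ℤ) < p) {x : Forms E G}
    (hx : x ∈ A.filtration p) : x = 0 := by
  refine A.ext_wproj fun a => ?_
  rw [map_zero]
  rcases lt_or_ge a p with h | h
  · exact A.mem_filtration.1 hx a h
  · exact A.wproj_eq_zero (Or.inr (by omega)) x

theorem mem_filtration_succ {p : ℤ} {x : Forms E G} (hx : x ∈ A.filtration p)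
    (h0 : A.wproj p x = 0) : x ∈ A.filtration (p + 1) :=
  A.mem_filtration.2 fun a ha => by
    rcases eq_or_ne a p with rfl | h
    · exact h0
    · exact A.mem_filtration.1 hx a (by omega)

theorem sum_wproj_add {p : ℤ} {N : ℕ} (hN : (A.homDim : ℤ) ≤ p + N) {x : Forms E G}
    (hx : x ∈ A.filtration p) : ∑ i ∈ Finset.range (N + 1), A.wproj (p + i) x = x := by
  refine A.ext_wproj fun c => ?_
  rw [map_sum]
  simp only [wproj_wproj]
  rcases lt_or_ge c p with hc | hc
  · rw [A.mem_filtration.1 hx c hc]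
    exact Finset.sum_eq_zero fun i _ => by rw [if_neg (by omega)]
  · rw [Finset.sum_eq_single (c - p).toNat]
    · rw [if_pos (by omega)]
    · intro i _ hi
      rw [if_neg (by omega)]
    · intro hi
      rw [Finset.mem_range] at hi
      rw [if_pos (by omega)]
      exact A.wproj_eq_zero (Or.inr (by omega)) x

theorem dW_apply (i : ℕ) (x : Forms E G) :
    A.dW i x = ∑ a ∈ Finset.range (A.homDim + 1), A.wproj ((a : ℤ) + i) (d E G (A.wproj a x)) := by
  rw [dW, LinearMap.sum_apply]
  rfl

theorem dW_wproj (i : ℕ) (a : ℤ) (x : Forms E G) :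
    A.dW i (A.wproj a x) = A.wproj (a + i) (d E G (A.wproj a x)) := by
  rw [dW_apply]
  by_cases ha : a < 0 ∨ (A.homDim : ℤ) < a
  · simp [A.wproj_eq_zero ha x]
  · rw [Finset.sum_eq_single a.toNat]
    · rw [wproj_wproj, if_pos (by omega), Int.toNat_of_nonneg (by omega)]
    · intro c _ hc
      rw [wproj_wproj, if_neg (by omega), map_zero, map_zero]
    · intro hc
      rw [Finset.mem_range] at hc
      omega

theorem wproj_dW (i : ℕ) (c : ℤ) (x : Forms E G) :
    A.wproj c (A.dW i x) = A.dW i (A.wproj (c - i) x) := by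
  rw [dW_wproj, dW_apply, map_sum, sub_add_cancel]
  simp only [wproj_wproj]
  by_cases ha : c - i < 0 ∨ (A.homDim : ℤ) < c - i
  · rw [A.wproj_eq_zero ha x, map_zero, map_zero]
    refine Finset.sum_eq_zero fun a ha' => ?_
    rw [Finset.mem_range] at ha'
    rw [if_neg (by omega)]
  · rw [Finset.sum_eq_single (c - i).toNat]
    · rw [if_pos (by omega), Int.toNat_of_nonneg (by omega)]
    · intro a _ ha'
      rw [if_neg (by omega)]
    · intro hc
      rw [Finset.mem_range] at hc
      omega

/-- Because `d` never lowers the weight, `d (x)_a` lives in weights from `a` up, and `N ≥ Q` steps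
reach the top weight. -/
theorem d_eq_sum {N : ℕ} (hN : A.homDim ≤ N) (x : Forms E G) :
    d E G x = ∑ i ∈ Finset.range (N + 1), A.dW i x := by
  simp only [dW_apply]
  rw [Finset.sum_comm]
  conv_lhs => rw [← A.sum_wproj x, map_sum]
  refine Finset.sum_congr rfl fun a _ => ?_
  refine (A.sum_wproj_add (by omega) (A.mem_filtration.2 fun c hc => ?_)).symm
  exact A.wproj_d_wproj_of_lt hc x

theorem wproj_d {N : ℕ} (hN : A.homDim ≤ N) (c : ℤ) (x : Forms E G) :
    A.wproj c (d E G x) = ∑ i ∈ Finset.range (N + 1), A.dW i (A.wproj (c - i) x) := by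
  rw [A.d_eq_sum hN, map_sum]
  simp only [wproj_dW]

/-- The component of weight `p + m` of `d x`, for `x` of weight at least `p`. -/
theorem wproj_add_d {p : ℤ} (m : ℕ) {x : Forms E G} (hx : x ∈ A.filtration p) :
    A.wproj (p + m) (d E G x) =
      ∑ i ∈ Finset.range (m + 1), A.dW i (A.wproj (p + (m - i : ℕ)) x) := by
  -- This bound is large enough to contain all `i ≤ m`; the terms with `i > m` involve components of
  -- `x` of weight below `p`.
  rw [A.wproj_d (N := A.homDim + m) (by omega)]
  have hs : Finset.range (m + 1) ⊆ Finset.range (A.homDim + m + 1) :=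
    Finset.range_subset_range.2 (by omega)
  rw [← Finset.sum_subset hs]
  · refine Finset.sum_congr rfl fun i hi => ?_
    rw [Finset.mem_range] at hi
    congr 3
    omega
  · intro i _ hi
    rw [Finset.mem_range] at hi
    rw [A.mem_filtration.1 hx _ (by omega), map_zero]

theorem dW_mem_filtration {p : ℤ} (i : ℕ) {x : Forms E G} (hx : x ∈ A.filtration p) :
    A.dW i x ∈ A.filtration (p + i) :=
  A.mem_filtration.2 fun a ha => by
    rw [wproj_dW, A.mem_filtration.1 hx _ (by omega), map_zero]

theorem d_mem_filtration {p : ℤ} {x : Forms E G} (hx : x ∈ A.filtration p) :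
    d E G x ∈ A.filtration p := by
  rw [A.d_eq_sum le_rfl]
  exact Submodule.sum_mem _ fun i _ => A.filtration_anti (by omega) (A.dW_mem_filtration i hx)

theorem d0inv_mem_filtration {p : ℤ} {x : Forms E G} (hx : x ∈ A.filtration p) :
    A.d0inv x ∈ A.filtration p :=
  A.mem_filtration.2 fun a ha => by
    rw [wproj_d0inv, A.mem_filtration.1 hx a ha, map_zero]

theorem projE0_apply (x : Forms E G) :
    A.projE0 x = x - A.dW 0 (A.d0inv x) - A.d0inv (A.dW 0 x) := rfl

theorem nilOp_apply (x : Forms E G) : A.nilOp x = A.d0inv (d E G x - A.dW 0 x) := rfl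

theorem wproj_dW_zero (a : ℤ) (x : Forms E G) : A.wproj a (A.dW 0 x) = A.dW 0 (A.wproj a x) := by
  rw [wproj_dW, Nat.cast_zero, sub_zero]

theorem wproj_projE0 (a : ℤ) (x : Forms E G) :
    A.wproj a (A.projE0 x) = A.projE0 (A.wproj a x) := by
  simp only [projE0_apply, map_sub, wproj_dW_zero, wproj_d0inv]

theorem projE0_mem_filtration {p : ℤ} {x : Forms E G} (hx : x ∈ A.filtration p) :
    A.projE0 x ∈ A.filtration p :=
  A.mem_filtration.2 fun a ha => by
    rw [wproj_projE0, A.mem_filtration.1 hx a ha, map_zero]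

theorem projE0_mem_ruminForms (x : Forms E G) : A.projE0 x ∈ A.ruminForms := by
  rw [mem_ruminForms]
  simp only [projE0_apply, map_sub, dW_zero_dW_zero, d0inv_d0inv, dW_zero_d0inv_dW_zero,
    d0inv_dW_zero_d0inv]
  simp

theorem wproj_mem_ruminForms (a : ℤ) {x : Forms E G} (hx : x ∈ A.ruminForms) :
    A.wproj a x ∈ A.ruminForms := by
  rw [mem_ruminForms] at hx ⊢
  rw [← wproj_dW_zero, ← wproj_d0inv, hx.1, hx.2, map_zero]
  exact ⟨rfl, rfl⟩

theorem projE0_dW_zero (x : Forms E G) : A.projE0 (A.dW 0 x) = 0 := by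
  rw [projE0_apply, dW_zero_d0inv_dW_zero, dW_zero_dW_zero, map_zero, sub_self, sub_zero]

theorem d_sub_dW_zero {N : ℕ} (hN : A.homDim ≤ N) (x : Forms E G) :
    d E G x - A.dW 0 x = ∑ i ∈ Finset.range N, A.dW (i + 1) x := by
  rw [A.d_eq_sum hN, Finset.sum_range_succ', add_sub_cancel_right]

theorem nilOp_mem_filtration {p : ℤ} {x : Forms E G} (hx : x ∈ A.filtration p) :
    A.nilOp x ∈ A.filtration (p + 1) := by
  rw [nilOp_apply, A.d_sub_dW_zero le_rfl]
  exact A.d0inv_mem_filtration (Submodule.sum_mem _ fun i _ =>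
    A.filtration_anti (by omega) (A.dW_mem_filtration (i + 1) hx))

theorem nilOp_pow_mem_filtration {p : ℤ} (k : ℕ) {x : Forms E G} (hx : x ∈ A.filtration p) :
    (A.nilOp ^ k) x ∈ A.filtration (p + k) := by
  induction k with
  | zero => simpa using hx
  | succ k ih =>
    rw [pow_succ', Module.End.mul_apply, Nat.cast_succ, ← add_assoc]
    exact A.nilOp_mem_filtration ih

/-- Each application raises the weight by at least 1, and all weights lie between 0 and `Q`. -/
theorem nilOp_pow_eq_zero : A.nilOp ^ (A.homDim + 1) = 0 :=
  LinearMap.ext fun x => A.eq_zero_of_mem_filtration (p := 0 + (A.homDim + 1 : ℕ)) (by omega)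
    (A.nilOp_pow_mem_filtration _ (A.mem_filtration_zero x))

theorem P_eq_geom : A.P = ∑ k ∈ Finset.range (A.homDim + 1), (-A.nilOp) ^ k := by
  refine Finset.sum_congr rfl fun k _ => ?_
  rw [← smul_pow, neg_one_smul]

/-- `P` is the geometric series of `-nilOp`, whose remainder vanishes by nilpotency. -/
theorem one_add_nilOp_mul_P : (1 + A.nilOp) * A.P = 1 := by
  have := mul_neg_geom_sum (-A.nilOp) (A.homDim + 1)
  rw [sub_neg_eq_add, neg_pow, nilOp_pow_eq_zero, mul_zero, sub_zero] at this
  rw [P_eq_geom, this]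

theorem P_mul_one_add_nilOp : A.P * (1 + A.nilOp) = 1 := by
  have := geom_sum_mul_neg (-A.nilOp) (A.homDim + 1)
  rw [sub_neg_eq_add, neg_pow, nilOp_pow_eq_zero, mul_zero, sub_zero] at this
  rw [P_eq_geom, this]

theorem P_add_nilOp_P (x : Forms E G) : A.P x + A.nilOp (A.P x) = x :=
  LinearMap.congr_fun A.one_add_nilOp_mul_P x

theorem P_add_P_nilOp (x : Forms E G) : A.P x + A.P (A.nilOp x) = x := by
  rw [← map_add]
  exact LinearMap.congr_fun A.P_mul_one_add_nilOp x

theorem P_mem_filtration {p : ℤ} {x : Forms E G} (hx : x ∈ A.filtration p) :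
    A.P x ∈ A.filtration p := by
  rw [P_eq_geom, LinearMap.sum_apply]
  refine Submodule.sum_mem _ fun k hk => ?_
  clear hk
  induction k with
  | zero => simpa using hx
  | succ k ih =>
    rw [pow_succ', Module.End.mul_apply, LinearMap.neg_apply]
    exact Submodule.neg_mem _ (A.filtration_anti (by omega) (A.nilOp_mem_filtration ih))

/-- `P x` differs from `x` by `nilOp (P x)`, of weight at least `p + 1`. Leading components thus
survive the passage from `E_0` to its lift. -/
theorem wproj_P_of_mem_filtration {p : ℤ} {x : Forms E G} (hx : x ∈ A.filtration p) :
    A.wproj p (A.P x) = A.wproj p x := by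
  conv_rhs => rw [← A.P_add_nilOp_P x, map_add, A.mem_filtration.1
    (A.nilOp_mem_filtration (A.P_mem_filtration hx)) p (by omega), add_zero]

theorem d0inv_d (x : Forms E G) : A.d0inv (d E G x) = A.nilOp x + A.d0inv (A.dW 0 x) := by
  rw [nilOp_apply, map_sub, sub_add_cancel]

/-- `P` is the identity modulo values of `nilOp`, which are values of `d_0⁻¹`; so it preserves the
range of `d_0⁻¹`. -/
theorem P_d0inv_eq (x : Forms E G) : ∃ u, A.P (A.d0inv x) = A.d0inv u := by
  refine ⟨x - (d E G (A.P (A.d0inv x)) - A.dW 0 (A.P (A.d0inv x))), ?_⟩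
  rw [map_sub, ← nilOp_apply, eq_sub_iff_add_eq]
  exact A.P_add_nilOp_P _

theorem d0inv_P_d0inv (x : Forms E G) : A.d0inv (A.P (A.d0inv x)) = 0 := by
  obtain ⟨u, hu⟩ := A.P_d0inv_eq x
  rw [hu, d0inv_d0inv]

/-- On the range of `d_0⁻¹` the operator `d_0⁻¹ d_0` is the identity, so `d_0⁻¹ d` acts there as `1
+ nilOp`, the inverse of `P`. -/
theorem d0inv_d_P_d0inv (x : Forms E G) : A.d0inv (d E G (A.P (A.d0inv x))) = A.d0inv x := by
  obtain ⟨u, hu⟩ := A.P_d0inv_eq x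
  have h1 : A.d0inv (A.dW 0 (A.P (A.d0inv x))) = A.P (A.d0inv x) := by
    rw [hu, d0inv_dW_zero_d0inv]
  rw [d0inv_d, h1, add_comm, P_add_nilOp_P]

theorem projE_apply (x : Forms E G) :
    A.projE x = x - d E G (A.P (A.d0inv x)) - A.P (A.d0inv (d E G x)) := rfl

theorem d0inv_projE (x : Forms E G) : A.d0inv (A.projE x) = 0 := by
  rw [projE_apply, map_sub, map_sub, d0inv_d_P_d0inv, d0inv_P_d0inv, sub_self, sub_zero]

theorem d0inv_d_projE (x : Forms E G) : A.d0inv (d E G (A.projE x)) = 0 := by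
  simp only [projE_apply, map_sub, d_d, d0inv_d_P_d0inv, sub_zero, sub_self]

/-- The second condition reads `d_0⁻¹ d_0 Y = -nilOp Y`, so `Π_{E_0} Y = (1 + nilOp) Y`. -/
theorem P_projE0 {Y : Forms E G} (h1 : A.d0inv Y = 0) (h2 : A.d0inv (d E G Y) = 0) :
    A.P (A.projE0 Y) = Y := by
  rw [d0inv_d, add_comm, add_eq_zero_iff_eq_neg] at h2
  rw [projE0_apply, h1, map_zero, sub_zero, h2, sub_neg_eq_add, map_add, P_add_P_nilOp]

/-- Here `d_0⁻¹ y = 0` and `d_0⁻¹ d y = nilOp y`, which leaves `y - P (nilOp y) = P y`. -/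
theorem projE_of_mem_ruminForms {y : Forms E G} (hy : y ∈ A.ruminForms) :
    A.projE y = A.P y := by
  rw [mem_ruminForms] at hy
  rw [projE_apply, d0inv_d, hy.1, hy.2]
  simp only [map_zero, sub_zero, add_zero]
  rw [sub_eq_iff_eq_add, P_add_P_nilOp]

theorem dc_apply (x : Forms E G) : A.dc x = A.projE0 (d E G (A.projE x)) := rfl

/-- `P` intertwines `d_c` on `E_0` with `d`. -/
theorem P_dc {y : Forms E G} (hy : y ∈ A.ruminForms) : A.P (A.dc y) = d E G (A.P y) := by
  rw [dc_apply, A.P_projE0 (A.d0inv_d_projE y) (by rw [d_d, map_zero]),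
    A.projE_of_mem_ruminForms hy]

theorem dc_mem_ruminForms (x : Forms E G) : A.dc x ∈ A.ruminForms := A.projE0_mem_ruminForms _

end AdaptedBasis
end RuminComplex

/-! ### Degrees, and the expansion of `d_c` into the `D_r` -/

section RuminDifferential
variable {E : Type*} [NormedAddCommGroup E] [NormedSpace ℝ E]
  {G : Type*} [TopologicalSpace G] [ChartedSpace E G]
  [FiniteDimensional ℝ E] [Group G] [LieGroup 𝓘(ℝ, E) ∞ G]

/-- Forms that are homogeneous of degree `k`; there are none but zero for `k < 0`. -/
def Forms.intDegree (k : ℤ) : Submodule ℝ (Forms E G) where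
  carrier := {α | ∀ h : ℕ, (h : ℤ) ≠ k → α h = 0}
  zero_mem' _ _ := rfl
  add_mem' {α β} ha hb h hk := by
    change α h + β h = 0
    rw [ha h hk, hb h hk, add_zero]
  smul_mem' c α ha h hk := by
    change c • α h = 0
    rw [ha h hk, smul_zero]

theorem Forms.mem_degree {h : ℕ} {α : Forms E G} :
    α ∈ Forms.degree h ↔ α ∈ Forms.intDegree (h : ℤ) :=
  ⟨fun H k hk => H k (by exact_mod_cast hk), fun H k hk => H k (by exact_mod_cast hk)⟩

theorem d_mem_intDegree {k : ℤ} {α : Forms E G} (hα : α ∈ Forms.intDegree k) :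
    d E G α ∈ Forms.intDegree (k + 1) := by
  intro h hk
  cases h with
  | zero => rfl
  | succ h =>
    change deRham (E := E) (G := G) h (α h) = 0
    rw [hα h (by push_cast at hk; omega), map_zero]

namespace AdaptedBasis
variable {S : Stratification E G} {n : ℕ} (A : AdaptedBasis S n)

theorem wproj_mem_intDegree (a : ℤ) {k : ℤ} {α : Forms E G} (hα : α ∈ Forms.intDegree k) :
    A.wproj a α ∈ Forms.intDegree k := by
  intro h hk
  change pointwise (covProj A.frame A.weight h a) (α h) = 0
  rw [hα h hk, map_zero]

theorem dW_mem_intDegree (i : ℕ) {k : ℤ} {α : Forms E G} (hα : α ∈ Forms.intDegree k) :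
    A.dW i α ∈ Forms.intDegree (k + 1) := by
  rw [dW_apply]
  exact Submodule.sum_mem _ fun a _ =>
    A.wproj_mem_intDegree _ (d_mem_intDegree (A.wproj_mem_intDegree _ hα))

theorem d0inv_mem_intDegree {k : ℤ} {α : Forms E G} (hα : α ∈ Forms.intDegree (k + 1)) :
    A.d0inv α ∈ Forms.intDegree k := by
  intro h hk
  change pointwise (partialInverse A.frame (covD0 E G h)) (α (h + 1)) = 0
  rw [hα (h + 1) (by push_cast; omega), map_zero]

theorem P_mem_intDegree {k : ℤ} {α : Forms E G} (hα : α ∈ Forms.intDegree k) :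
    A.P α ∈ Forms.intDegree k := by
  rw [P_eq_geom, LinearMap.sum_apply]
  refine Submodule.sum_mem _ fun m hm => ?_
  clear hm
  induction m with
  | zero => simpa using hα
  | succ m ih =>
    rw [pow_succ', Module.End.mul_apply, LinearMap.neg_apply]
    exact Submodule.neg_mem _ (A.d0inv_mem_intDegree
      (Submodule.sub_mem _ (d_mem_intDegree ih) (A.dW_mem_intDegree 0 ih)))

theorem projE0_mem_intDegree {k : ℤ} {α : Forms E G} (hα : α ∈ Forms.intDegree k) :
    A.projE0 α ∈ Forms.intDegree k := by
  refine Submodule.sub_mem _ (Submodule.sub_mem _ hα ?_)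
    (A.d0inv_mem_intDegree (A.dW_mem_intDegree 0 hα))
  -- Integer degrees allow `k - 1 = -1` here: on functions `d_0⁻¹` has nowhere to go.
  have := A.dW_mem_intDegree 0 (A.d0inv_mem_intDegree (k := k - 1) (by rwa [sub_add_cancel]))
  rwa [sub_add_cancel] at this

theorem dc_mem_intDegree {k : ℤ} {α : Forms E G} (hα : α ∈ Forms.intDegree k) :
    A.dc α ∈ Forms.intDegree (k + 1) := by
  refine A.projE0_mem_intDegree (d_mem_intDegree ?_)
  refine Submodule.sub_mem _ (Submodule.sub_mem _ hα ?_)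
    (A.P_mem_intDegree (A.d0inv_mem_intDegree (d_mem_intDegree hα)))
  have := d_mem_intDegree (A.P_mem_intDegree (A.d0inv_mem_intDegree (k := k - 1) (α := α)
    (by rwa [sub_add_cancel])))
  rwa [sub_add_cancel] at this

/-- Splits off the first letter `i` of a word; the tail is a word of length `m` and sum `j - i`. -/
theorem words_succ (m j : ℕ) :
    A.words (m + 1) j =
      ∑ i ∈ Finset.Icc 1 j, A.d0inv * A.dW i * A.words m (j - i) := by
  simp only [words, Finset.mul_sum]
  rw [Finset.sum_sigma']
  symm
  refine Finset.sum_bij' (fun s _ => (Fin.cons s.1 s.2 : Fin (m + 1) → ℕ))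
    (fun I _ => ⟨I 0, Fin.tail I⟩) ?_ ?_ ?_ ?_ ?_
  · rintro ⟨i, I⟩ hs
    simp only [Finset.mem_sigma, Finset.mem_filter, Finset.Nat.mem_antidiagonalTuple,
      Finset.mem_Icc] at hs ⊢
    refine ⟨?_, fun k => Fin.cases ?_ (fun k => ?_) k⟩
    · rw [Fin.sum_univ_succ]
      simp only [Fin.cons_zero, Fin.cons_succ, hs.2.1]
      omega
    · simpa using hs.1.1
    · simpa using hs.2.2 k
  · intro I hI
    simp only [Finset.mem_sigma, Finset.mem_filter, Finset.Nat.mem_antidiagonalTuple,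
      Finset.mem_Icc] at hI ⊢
    rw [Fin.sum_univ_succ] at hI
    refine ⟨⟨hI.2 0, by omega⟩, ?_, fun k => hI.2 k.succ⟩
    simp only [Fin.tail]
    omega
  · rintro ⟨i, I⟩ _
    simp
  · intro I _
    simp
  · rintro ⟨i, I⟩ _
    simp [List.ofFn_succ]

theorem words_zero (j : ℕ) : A.words 0 j = if j = 0 then 1 else 0 := by
  cases j with
  | zero => simp [words]
  | succ j => simp [words]

theorem words_eq_zero {m j : ℕ} (h : j < m) : A.words m j = 0 := by
  refine Finset.sum_eq_zero fun I hI => ?_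
  rw [Finset.mem_filter, Finset.Nat.mem_antidiagonalTuple] at hI
  have := Finset.sum_le_sum (s := Finset.univ) fun k _ => hI.2 k
  simp at this
  omega

/-- The part of the series for `P` that raises the weight by `j`. Positive entries bound the length
of a word by `j`, so any `M > j` gives the same sum; the empty word counts only for `j = 0`. -/
theorem sum_words {M j : ℕ} (h : j < M) :
    ∑ m ∈ Finset.range M, (-1 : ℝ) ^ m • A.words m j = if j = 0 then 1 else -A.zOp j := by
  obtain ⟨M, rfl⟩ : ∃ N, M = N + 1 := ⟨M - 1, by omega⟩
  rw [Finset.sum_range_succ', pow_zero, one_smul, words_zero]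
  have e : ∑ m ∈ Finset.range M, (-1 : ℝ) ^ (m + 1) • A.words (m + 1) j = -A.zOp j := by
    rw [zOp, ← Finset.sum_neg_distrib]
    have hs : Finset.Icc 1 j ⊆ Finset.Icc 1 M := Finset.Icc_subset_Icc le_rfl (by omega)
    rw [Finset.sum_subset hs]
    · rw [Finset.range_eq_Ico, Finset.sum_Ico_add' (fun m => (-1 : ℝ) ^ m • A.words m j) 0 M 1]
      refine Finset.sum_congr (by ext; simp) fun m hm => ?_
      obtain ⟨k, rfl⟩ : ∃ k, m = k + 1 := ⟨m - 1, by simp at hm; omega⟩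
      rw [Nat.add_sub_cancel, pow_succ, mul_neg_one, neg_smul]
    · intro m _ hm
      rw [Finset.mem_Icc] at hm
      rw [A.words_eq_zero (by simp_all), smul_zero, neg_zero]
  rw [e]
  split_ifs with hj
  · simp [hj, zOp]
  · simp

/-- Peeling the first letter off every word leaves the alternating sum over tails: the identity when
`i = j`, and `-ζ_{j-i}` otherwise. This is `d_0⁻¹` applied to the definition of `D_j`. -/
theorem zOp_eq (j : ℕ) (hj : 1 ≤ j) : A.zOp j = A.d0inv * A.diffPart j := by
  have h1 : A.zOp j = ∑ m ∈ Finset.range j, (-1 : ℝ) ^ m • A.words (m + 1) j := by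
    have e := Finset.sum_Ico_add' (fun m => (-1 : ℝ) ^ (m - 1) • A.words m j) 0 j 1
    simp only [Nat.add_sub_cancel] at e
    rw [zOp, Finset.range_eq_Ico, e]
    exact Finset.sum_congr (by ext; simp) fun _ _ => rfl
  have h2 : A.zOp j = ∑ i ∈ Finset.Icc 1 j, A.d0inv * A.dW i *
      (if j - i = 0 then 1 else -A.zOp (j - i)) := by
    rw [h1]
    simp only [words_succ, Finset.smul_sum]
    rw [Finset.sum_comm]
    refine Finset.sum_congr rfl fun i hi => ?_
    rw [Finset.mem_Icc] at hi
    rw [← A.sum_words (M := j) (by omega), Finset.mul_sum]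
    simp only [mul_smul_comm]
  rw [h2, diffPart, mul_sub, Finset.mul_sum, ← Finset.Ico_insert_right hj,
    Finset.sum_insert (by simp), Nat.sub_self, if_pos rfl, mul_one, sub_eq_add_neg,
    ← Finset.sum_neg_distrib]
  congr 1
  refine Finset.sum_congr rfl fun i hi => ?_
  rw [Finset.mem_Ico] at hi
  rw [if_neg (by omega), mul_neg, mul_assoc]

theorem zOp_apply {j : ℕ} (hj : 1 ≤ j) (x : Forms E G) :
    A.zOp j x = A.d0inv (A.diffPart j x) := by
  rw [A.zOp_eq j hj]
  rfl

theorem diffPart_apply (r : ℕ) (x : Forms E G) :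
    A.diffPart r x = A.dW r x - ∑ i ∈ Finset.Ico 1 r, A.dW i (A.zOp (r - i) x) := by
  simp [diffPart, LinearMap.sum_apply]

theorem sum_range_eq_Ico_add {M : Type*} [AddCommMonoid M] (f : ℕ → M) {m : ℕ} (hm : 1 ≤ m) :
    ∑ i ∈ Finset.range (m + 1), f i = f 0 + ∑ i ∈ Finset.Ico 1 m, f i + f m := by
  rw [Finset.sum_range_succ, Finset.range_eq_Ico, Finset.sum_eq_sum_Ico_succ_bot hm]

/-- The components of `P x`, for `x` of pure weight. -/
theorem wproj_P {p : ℤ} {x : Forms E G} (hx : x ∈ A.weightForms p) (m : ℕ) (hm : 1 ≤ m) :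
    A.wproj (p + m) (A.P x) = -A.zOp m x := by
  induction m using Nat.strong_induction_on with
  | _ m ih =>
    have hF : A.P x ∈ A.filtration p :=
      A.P_mem_filtration (A.weightForms_le_filtration le_rfl hx)
    have h0 : A.wproj p (A.P x) = x := by
      rw [A.wproj_P_of_mem_filtration (A.weightForms_le_filtration le_rfl hx),
        A.mem_weightForms.1 hx]
    -- In weight `p + m` with `m ≥ 1` the right side `x` has no component, and subtracting `d_0`
    -- removes the `i = 0` term. The component of `P x` is thereby determined by those of lower
    -- weight.
    have h1 := congrArg (A.wproj (p + m)) (A.P_add_nilOp_P x)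
    rw [A.wproj_of_mem_weightForms hx, if_neg (by omega), map_add, nilOp_apply, wproj_d0inv,
      map_sub, A.wproj_add_d m hF, wproj_dW_zero, sum_range_eq_Ico_add _ hm, Nat.sub_zero,
      Nat.sub_self, Nat.cast_zero, add_zero, h0] at h1
    rw [eq_neg_of_add_eq_zero_left h1, A.zOp_apply hm, diffPart_apply]
    congr 2
    have e : ∑ i ∈ Finset.Ico 1 m, A.dW i (A.wproj (p + (m - i : ℕ)) (A.P x)) =
        -∑ i ∈ Finset.Ico 1 m, A.dW i (A.zOp (m - i) x) := by
      rw [← Finset.sum_neg_distrib]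
      refine Finset.sum_congr rfl fun i hi => ?_
      rw [Finset.mem_Ico] at hi
      rw [ih (m - i) (by omega) (by omega), map_neg]
    rw [e]
    abel

/-- The components of `d (P x)`, for `x` of pure weight. -/
theorem wproj_d_P {p : ℤ} {x : Forms E G} (hx : x ∈ A.weightForms p) (r : ℕ) (hr : 1 ≤ r) :
    A.wproj (p + r) (d E G (A.P x)) = A.diffPart r x - A.dW 0 (A.zOp r x) := by
  have hF : A.P x ∈ A.filtration p :=
    A.P_mem_filtration (A.weightForms_le_filtration le_rfl hx)
  have h0 : A.wproj p (A.P x) = x := by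
    rw [A.wproj_P_of_mem_filtration (A.weightForms_le_filtration le_rfl hx),
      A.mem_weightForms.1 hx]
  rw [A.wproj_add_d r hF, sum_range_eq_Ico_add _ hr, Nat.sub_zero, Nat.sub_self, Nat.cast_zero,
    add_zero, h0, A.wproj_P hx r hr, diffPart_apply, map_neg]
  have e : ∑ i ∈ Finset.Ico 1 r, A.dW i (A.wproj (p + (r - i : ℕ)) (A.P x)) =
      -∑ i ∈ Finset.Ico 1 r, A.dW i (A.zOp (r - i) x) := by
    rw [← Finset.sum_neg_distrib]
    refine Finset.sum_congr rfl fun i hi => ?_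
    rw [Finset.mem_Ico] at hi
    rw [A.wproj_P hx (r - i) (by omega), map_neg]
  rw [e]
  abel

theorem dc_of_mem_ruminForms {y : Forms E G} (hy : y ∈ A.ruminForms) :
    A.dc y = A.projE0 (d E G (A.P y)) := by
  rw [dc_apply, A.projE_of_mem_ruminForms hy]

/-- The component of `d (P α)` differs from `D_r α` by an element of `im d_0`, which `Π_{E_0}`
kills. -/
theorem wproj_dc {p : ℤ} {α : Forms E G} (hα : α ∈ A.ruminForms) (hp : α ∈ A.weightForms p)
    (r : ℕ) (hr : 1 ≤ r) : A.wproj (p + r) (A.dc α) = A.projE0 (A.diffPart r α) := by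
  rw [A.dc_of_mem_ruminForms hα, wproj_projE0, A.wproj_d_P hp r hr, map_sub, projE0_dW_zero,
    sub_zero]

theorem dc_eq_sum_of_mem_weightForms {N a : ℕ} (hN : A.homDim ≤ N) {α : Forms E G}
    (hα : α ∈ A.ruminForms) (ha : α ∈ A.weightForms a) :
    A.dc α = A.projE0 (∑ r ∈ Finset.Icc 1 N, A.diffPart r α) := by
  have hF : α ∈ A.filtration a := A.weightForms_le_filtration le_rfl ha
  have hd : A.dc α ∈ A.filtration a := by
    rw [A.dc_of_mem_ruminForms hα]
    exact A.projE0_mem_filtration (A.d_mem_filtration (A.P_mem_filtration hF))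
  -- The component of weight `a` of `d (P α)` lies in `im d_0`, so `d_c` has no part that keeps the
  -- weight and the sum starts at `r = 1`.
  have h0 : A.wproj a (A.dc α) = 0 := by
    have := A.wproj_add_d 0 (A.P_mem_filtration hF)
    rw [A.dc_of_mem_ruminForms hα, wproj_projE0]
    simp only [Nat.cast_zero, add_zero, zero_add, Finset.sum_range_one, Nat.sub_zero] at this
    rw [this, projE0_dW_zero]
  rw [← A.sum_wproj_add (N := N) (by omega) hd, Finset.sum_range_succ', Nat.cast_zero, add_zero,
    h0, add_zero, map_sum, Finset.range_eq_Ico,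
    Finset.sum_Ico_add' (fun r => A.wproj ((a : ℤ) + (r : ℕ)) (A.dc α)) 0 N 1]
  refine Finset.sum_congr (by ext; simp) fun r hr => ?_
  exact A.wproj_dc hα ha r (by simp at hr; omega)

theorem dc_eq_sum {N : ℕ} (hN : A.homDim ≤ N) {α : Forms E G} (hα : α ∈ A.ruminForms) :
    A.dc α = A.projE0 (∑ r ∈ Finset.Icc 1 N, A.diffPart r α) := by
  have e : ∀ β : Forms E G, ∑ r ∈ Finset.Icc 1 N, A.diffPart r β =
      (∑ r ∈ Finset.Icc 1 N, A.diffPart r) β := fun β => (LinearMap.sum_apply _ _ _).symm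
  rw [e, ← A.sum_wproj α]
  simp only [map_sum]
  refine Finset.sum_congr rfl fun a _ => ?_
  rw [← e]
  exact A.dc_eq_sum_of_mem_weightForms hN (A.wproj_mem_ruminForms _ hα)
    (A.wproj_mem_weightForms _ _)

end AdaptedBasis
end RuminDifferential

/-! ### The pages as quotients `Z_r / B_r`, and their differentials -/

theorem cls_congr {M : Type*} [AddCommGroup M] [Module ℝ M] {Z B : Submodule ℝ M} {x y : M}
    {hx : x ∈ Z} {hy : y ∈ Z} (h : x = y) : cls Z B x hx = cls Z B y hy := by
  subst h
  rfl

theorem cls_eq_iff {M : Type*} [AddCommGroup M] [Module ℝ M] {Z B : Submodule ℝ M} {x y : M}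
    {hx : x ∈ Z} {hy : y ∈ Z} : cls Z B x hx = cls Z B y hy ↔ x - y ∈ B :=
  Submodule.Quotient.eq _

theorem mem_cycles {M : Type*} [AddCommGroup M] [Module ℝ M] {d : Module.End ℝ M}
    {F : ℤ → Submodule ℝ M} {r : ℕ} {p : ℤ} {x : M} :
    x ∈ cycles d F r p ↔ x ∈ F p ∧ d x ∈ F (p + r) := Iff.rfl

section SpectralSequenceOfWeights
variable {E : Type*} [NormedAddCommGroup E] [NormedSpace ℝ E]
  {G : Type*} [TopologicalSpace G] [ChartedSpace E G]
  [FiniteDimensional ℝ E] [Group G] [LieGroup 𝓘(ℝ, E) ∞ G]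

namespace AdaptedBasis
variable {S : Stratification E G} {n : ℕ} (A : AdaptedBasis S n)

theorem IsZigzag.congr {r : ℕ} {p : ℤ} {x : Forms E G} {z z' : ℕ → Forms E G}
    (H : A.IsZigzag r p x z) (h : ∀ j, 1 ≤ j → j < r → z j = z' j) : A.IsZigzag r p x z' := by
  refine ⟨fun j h1 h2 => h j h1 h2 ▸ H.1 j h1 h2, H.2.1, fun m h1 h2 => ?_⟩
  rw [H.2.2 m h1 h2]
  refine Finset.sum_congr rfl fun i hi => ?_
  rw [Finset.mem_range] at hi
  rw [h (m - i) (by omega) (by omega)]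

/-- `(⋆)` is the vanishing of `d x` in weights `p + m`, `m < r`, solved for `d_m (x)_p`. The minus
sign comes from moving the other terms across. -/
theorem isZigzag_of_mem_cycles {r : ℕ} (hr : 1 ≤ r) {p : ℤ} {x : Forms E G}
    (hx : x ∈ cycles (d E G) A.filtration r p) :
    A.IsZigzag r p (A.wproj p x) (fun j => -A.wproj (p + j) x) := by
  have hd : ∀ m, m < r → A.wproj (p + m) (d E G x) = 0 := fun m hm =>
    A.mem_filtration.1 hx.2 _ (by omega)
  refine ⟨fun j _ _ => Submodule.neg_mem _ (A.wproj_mem_weightForms _ _), ?_, fun m h1 h2 => ?_⟩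
  · have := A.wproj_add_d 0 hx.1
    rw [hd 0 (by omega)] at this
    simpa using this.symm
  · have := A.wproj_add_d m hx.1
    rw [hd m h2, Finset.sum_range_succ, Nat.sub_self, Nat.cast_zero, add_zero, add_comm] at this
    rw [eq_neg_of_add_eq_zero_left this.symm, ← Finset.sum_neg_distrib]
    simp only [map_neg]

theorem wproj_mem_Z {r : ℕ} (hr : 1 ≤ r) {p : ℤ} {x : Forms E G}
    (hx : x ∈ cycles (d E G) A.filtration r p) : A.wproj p x ∈ A.Z r p :=
  ⟨A.wproj_mem_weightForms _ _, _, A.isZigzag_of_mem_cycles hr hx⟩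

section ZigzagLift
variable {r : ℕ} {p : ℤ} {x : Forms E G} {z : ℕ → Forms E G}

theorem wproj_zigzag (hx : x ∈ A.weightForms p) (H : A.IsZigzag r p x z) (j : ℕ) :
    A.wproj (p + j) (x - ∑ k ∈ Finset.Ico 1 r, z k) =
      if j = 0 then x else if j < r then -z j else 0 := by
  have e : ∀ k ∈ Finset.Ico 1 r, A.wproj (p + j) (z k) = if j = k then z k else 0 := by
    intro k hk
    rw [Finset.mem_Ico] at hk
    rw [A.wproj_of_mem_weightForms (H.1 k hk.1 hk.2)]
    simp
  rw [map_sub, map_sum, Finset.sum_congr rfl e, A.wproj_of_mem_weightForms hx,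
    Finset.sum_ite_eq]
  by_cases h0 : j = 0
  · simp [h0]
  · by_cases h1 : j < r
    · simp [h0, h1]
    · simp [h0, h1]

theorem wproj_zigzag_zero (hx : x ∈ A.weightForms p) (H : A.IsZigzag r p x z) :
    A.wproj p (x - ∑ k ∈ Finset.Ico 1 r, z k) = x := by
  simpa using A.wproj_zigzag hx H 0

theorem zigzag_mem_filtration (hx : x ∈ A.weightForms p) (H : A.IsZigzag r p x z) :
    x - ∑ k ∈ Finset.Ico 1 r, z k ∈ A.filtration p := by
  refine Submodule.sub_mem _ (A.weightForms_le_filtration le_rfl hx)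
    (Submodule.sum_mem _ fun k hk => ?_)
  rw [Finset.mem_Ico] at hk
  exact A.weightForms_le_filtration (by omega) (H.1 k hk.1 hk.2)

/-- The converse reading of `(⋆)`: the equations cancel every component of the differential below
weight `p + r`. -/
theorem zigzag_mem_cycles (hx : x ∈ A.weightForms p) (H : A.IsZigzag r p x z) :
    x - ∑ k ∈ Finset.Ico 1 r, z k ∈ cycles (d E G) A.filtration r p := by
  have hF := A.zigzag_mem_filtration hx H
  refine ⟨hF, A.mem_filtration.2 fun a ha => ?_⟩
  rcases lt_or_ge a p with hap | hap
  · exact A.mem_filtration.1 (A.d_mem_filtration hF) a hap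
  obtain ⟨m, rfl⟩ : ∃ m : ℕ, a = p + m := ⟨(a - p).toNat, by omega⟩
  have hm : m < r := by omega
  rw [A.wproj_add_d m hF]
  simp only [A.wproj_zigzag hx H]
  rw [Finset.sum_range_succ, Nat.sub_self, if_pos rfl]
  rcases Nat.eq_zero_or_pos m with rfl | h0
  · simpa using H.2.1
  · rw [H.2.2 m h0 hm, ← Finset.sum_add_distrib]
    refine Finset.sum_eq_zero fun i hi => ?_
    rw [Finset.mem_range] at hi
    rw [if_neg (by omega), if_pos (by omega), map_neg, neg_add_cancel]

theorem wproj_d_zigzag (hr : 1 ≤ r) (hx : x ∈ A.weightForms p) (H : A.IsZigzag r p x z) :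
    A.wproj (p + r) (d E G (x - ∑ k ∈ Finset.Ico 1 r, z k)) =
      A.dW r x - ∑ i ∈ Finset.Ico 1 r, A.dW i (z (r - i)) := by
  rw [A.wproj_add_d r (A.zigzag_mem_filtration hx H)]
  simp only [A.wproj_zigzag hx H]
  -- The lift has no component of weight `p + r`, so the `d_0` term drops out.
  rw [sum_range_eq_Ico_add _ hr, Nat.sub_self, if_pos rfl, Nat.sub_zero, if_neg (by omega),
    if_neg (by omega), map_zero, zero_add, add_comm, sub_eq_add_neg, ← Finset.sum_neg_distrib]
  congr 1
  refine Finset.sum_congr rfl fun i hi => ?_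
  rw [Finset.mem_Ico] at hi
  rw [if_neg (by omega), if_pos (by omega), map_neg]

end ZigzagLift

theorem wproj_sub_d {s l : ℕ} (hl : l ≤ s) {p : ℤ} {c : Forms E G}
    (hc : c ∈ A.filtration (p - s)) :
    A.wproj (p - l) (d E G c) =
      ∑ k ∈ Finset.Ico l (s + 1), A.dW (k - l) (A.wproj (p - k) c) := by
  have h1 : p - (l : ℤ) = p - s + (s - l : ℕ) := by omega
  rw [h1, A.wproj_add_d _ hc, Finset.sum_Ico_eq_sum_range]
  refine Finset.sum_congr (by congr 1; omega) fun i hi => ?_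
  rw [Finset.mem_range] at hi
  rw [Nat.add_sub_cancel_left]
  congr 3
  omega

/-- The summand from `F_{p+1}` has no component of weight `p`. For the summand `d c`, the conditions
in `B` express that `d c` vanishes in weights below `p`. -/
theorem wproj_mem_B {r : ℕ} (hr : 1 ≤ r) {p : ℤ} {x : Forms E G}
    (hx : x ∈ boundaries (d E G) A.filtration r p) : A.wproj p x ∈ A.B r p := by
  obtain ⟨s, rfl⟩ : ∃ s, r = s + 1 := ⟨r - 1, by omega⟩
  obtain ⟨u, hu, v, ⟨c, hc, rfl⟩, rfl⟩ := Submodule.mem_sup.1 hx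
  rw [map_add, A.mem_filtration.1 hu.1 p (by omega), zero_add]
  refine ⟨fun k => A.wproj (p - k) c, fun k _ => A.wproj_mem_weightForms _ _, ?_,
    fun l h1 h2 => ?_⟩
  · have := A.wproj_sub_d (l := 0) (Nat.zero_le s) hc.1
    rw [Nat.cast_zero, sub_zero] at this
    rw [this, Finset.range_eq_Ico]
    simp only [Nat.sub_zero]
  · rw [← A.wproj_sub_d (by omega) hc.1]
    refine (A.mem_filtration.1 hc.2 _ ?_).symm
    omega

theorem exists_boundary {s : ℕ} {p : ℤ} {x : Forms E G} (hx : x ∈ A.B (s + 1) p) :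
    ∃ c ∈ cycles (d E G) A.filtration s (p - s), A.wproj p (d E G c) = x := by
  obtain ⟨c, h1, rfl, h3⟩ := hx
  have hF : ∑ k ∈ Finset.range (s + 1), c k ∈ A.filtration (p - s) := by
    refine Submodule.sum_mem _ fun k hk => ?_
    rw [Finset.mem_range] at hk
    exact A.weightForms_le_filtration (by omega) (h1 k hk)
  have hw : ∀ k, k < s + 1 → A.wproj (p - k) (∑ k ∈ Finset.range (s + 1), c k) = c k := by
    intro k hk
    have e : ∀ j ∈ Finset.range (s + 1), A.wproj (p - k) (c j) = if k = j then c j else 0 := by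
      intro j hj
      rw [A.wproj_of_mem_weightForms (h1 j (Finset.mem_range.1 hj))]
      simp
    rw [map_sum, Finset.sum_congr rfl e, Finset.sum_ite_eq, if_pos (Finset.mem_range.2 hk)]
  have hd : ∀ l ≤ s, A.wproj (p - l) (d E G (∑ k ∈ Finset.range (s + 1), c k)) =
      ∑ k ∈ Finset.Ico l (s + 1), A.dW (k - l) (c k) := by
    intro l hl
    rw [A.wproj_sub_d hl hF]
    refine Finset.sum_congr rfl fun k hk => ?_
    rw [hw k (Finset.mem_Ico.1 hk).2]
  refine ⟨_, ⟨hF, A.mem_filtration.2 fun a ha => ?_⟩, ?_⟩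
  · rcases lt_or_ge a (p - s) with hap | hap
    · exact A.mem_filtration.1 (A.d_mem_filtration hF) a hap
    · obtain ⟨l, rfl⟩ : ∃ l : ℕ, a = p - l := ⟨(p - a).toNat, by omega⟩
      rw [hd l (by omega), ← h3 l (by omega) (by omega)]
  · have := hd 0 (Nat.zero_le _)
    rw [Nat.cast_zero, sub_zero] at this
    rw [this, Finset.range_eq_Ico]
    simp only [Nat.sub_zero]

/-- Subtracting a `d c` with the same leading component moves `x` into `F_{p+1}` without changing `d
x`. The remainder is thus an `(r-1)`-cycle there, which is an `r`-boundary. -/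
theorem mem_boundaries_of_wproj_mem_B {r : ℕ} (hr : 1 ≤ r) {p : ℤ} {x : Forms E G}
    (hx : x ∈ cycles (d E G) A.filtration r p) (hB : A.wproj p x ∈ A.B r p) :
    x ∈ boundaries (d E G) A.filtration r p := by
  obtain ⟨s, rfl⟩ : ∃ s, r = s + 1 := ⟨r - 1, by omega⟩
  obtain ⟨c, hc, hcx⟩ := A.exists_boundary hB
  have hdc : d E G c ∈ A.filtration p := by
    have := hc.2
    rwa [sub_add_cancel] at this
  have h1 : x - d E G c ∈ cycles (d E G) A.filtration s (p + 1) := by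
    refine mem_cycles.2 ⟨A.mem_filtration_succ (Submodule.sub_mem _ hx.1 hdc) ?_, ?_⟩
    · rw [map_sub, hcx, sub_self]
    · rw [map_sub, d_d, sub_zero]
      exact A.filtration_anti (by push_cast; omega) hx.2
  refine Submodule.mem_sup.2 ⟨_, h1, d E G c, ⟨c, hc, rfl⟩, sub_add_cancel _ _⟩

/-- The map `E_r^{p,*} → Z_r^{p,*} / B_r^{p,*}`, `[x] ↦ [(x)_p]`. -/
def pageMap {r : ℕ} (hr : 1 ≤ r) (p : ℤ) : A.specPage r p →ₗ[ℝ] A.ZB r p :=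
  Submodule.mapQ _ _
    ((A.wproj p).restrict fun _ hx => A.wproj_mem_Z hr hx)
    (fun _ hx => A.wproj_mem_B hr hx)

theorem pageMap_cls {r : ℕ} (hr : 1 ≤ r) (p : ℤ) {x : Forms E G}
    (hx : x ∈ cycles (d E G) A.filtration r p) :
    A.pageMap hr p (cls _ _ x hx) = cls _ _ (A.wproj p x) (A.wproj_mem_Z hr hx) := rfl

theorem pageMap_bijective {r : ℕ} (hr : 1 ≤ r) (p : ℤ) :
    Function.Bijective (A.pageMap hr p) := by
  constructor
  · rw [injective_iff_map_eq_zero]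
    intro ξ hξ
    obtain ⟨⟨x, hx⟩, rfl⟩ := Submodule.Quotient.mk_surjective _ ξ
    refine (Submodule.Quotient.mk_eq_zero _).2 ?_
    have hB : (⟨A.wproj p x, A.wproj_mem_Z hr hx⟩ : A.Z r p) ∈ (A.B r p).submoduleOf (A.Z r p) :=
      (Submodule.Quotient.mk_eq_zero _).1 hξ
    exact A.mem_boundaries_of_wproj_mem_B hr hx hB
  · intro ξ
    obtain ⟨⟨x, hx, z, H⟩, rfl⟩ := Submodule.Quotient.mk_surjective _ ξ
    exact ⟨cls _ _ _ (A.zigzag_mem_cycles hx H), cls_congr (A.wproj_zigzag_zero hx H)⟩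

/-- The isomorphism `E_r^{p,*} ≅ Z_r^{p,*} / B_r^{p,*}`, `[x] ↦ [(x)_p]`. -/
def pageEquiv {r : ℕ} (hr : 1 ≤ r) (p : ℤ) : A.specPage r p ≃ₗ[ℝ] A.ZB r p :=
  LinearEquiv.ofBijective (A.pageMap hr p) (A.pageMap_bijective hr p)

theorem partialD_wproj {r : ℕ} (hr : 1 ≤ r) {p : ℤ} {X : Forms E G}
    (hX : X ∈ cycles (d E G) A.filtration r p) :
    A.partialD r (A.pageEquiv hr) p (cls _ _ (A.wproj p X) (A.wproj_mem_Z hr hX)) =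
      cls _ _ (A.wproj (p + r) (d E G X))
        (A.wproj_mem_Z hr (map_cycles (d E G) d_d A.filtration r p X hX)) := by
  have h1 : (A.pageEquiv hr p).symm (cls _ _ (A.wproj p X) (A.wproj_mem_Z hr hX)) =
      cls _ _ X hX := by
    rw [LinearEquiv.symm_apply_eq]
    rfl
  change A.pageEquiv hr (p + r) (A.specDiff r p ((A.pageEquiv hr p).symm _)) = _
  rw [h1]
  rfl

/-- The differential of the `r`-th page, computed on a lift `X` of a class of `Z_r / B_r`. -/
theorem exists_partialD_eq {r : ℕ} (hr : 1 ≤ r) {p : ℤ} {X x y : Forms E G}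
    (hX : X ∈ cycles (d E G) A.filtration r p) (hx : A.wproj p X = x)
    (hy : A.wproj (p + r) (d E G X) = y) :
    ∃ (hx' : x ∈ A.Z r p) (hy' : y ∈ A.Z r (p + r)),
      A.partialD r (A.pageEquiv hr) p (cls _ _ x hx') = cls _ _ y hy' := by
  subst hx hy
  exact ⟨_, _, A.partialD_wproj hr hX⟩

/-- With the earlier `z` known, `(⋆)` reads `d_0 (z j) = D_j x`; orthogonality to `ker d_0` lets
`d_0⁻¹` recover `z j`. -/
theorem eq_zOp_of_ortho {r : ℕ} {p : ℤ} {x : Forms E G} {z : ℕ → Forms E G}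
    (H : A.IsZigzag r p x z)
    (ho : ∀ j, 1 ≤ j → j < r → ∀ κ, A.dW 0 κ = 0 → A.Ortho (z j) κ) (j : ℕ) (h1 : 1 ≤ j)
    (h2 : j < r) : z j = A.zOp j x := by
  induction j using Nat.strong_induction_on with
  | _ j ih =>
    have e := H.2.2 j h1 h2
    rw [Finset.range_eq_Ico, Finset.sum_eq_sum_Ico_succ_bot (by omega), Nat.sub_zero] at e
    have e2 : A.dW 0 (z j) = A.diffPart j x := by
      rw [diffPart_apply, e, eq_sub_iff_add_eq]
      congr 1
      refine Finset.sum_congr rfl fun i hi => ?_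
      rw [Finset.mem_Ico] at hi
      rw [ih (j - i) (by omega) (by omega) (by omega)]
    rw [← A.d0inv_dW_zero_of_ortho (ho j h1 h2), e2, A.zOp_apply h1]

theorem P_mem_cycles {r : ℕ} {p : ℤ} {y : Forms E G} (hy : y ∈ A.ruminForms)
    (hp : y ∈ A.filtration p) (hdc : A.dc y ∈ A.filtration (p + r)) :
    A.P y ∈ cycles (d E G) A.filtration r p := by
  refine mem_cycles.2 ⟨A.P_mem_filtration hp, ?_⟩
  rw [← A.P_dc hy]
  exact A.P_mem_filtration hdc

/-- `P α` is an `r`-cycle lifting `α`, and its higher components are `-ζ_j α`. -/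
theorem isZigzag_zOp {r : ℕ} (hr : 1 ≤ r) {p : ℤ} {α : Forms E G} (hα : α ∈ A.ruminForms)
    (hp : α ∈ A.weightForms p) (hdc : A.dc α ∈ A.filtration (p + r)) :
    A.IsZigzag r p α (fun j => A.zOp j α) := by
  have hF := A.weightForms_le_filtration le_rfl hp
  have H := A.isZigzag_of_mem_cycles hr (A.P_mem_cycles hα hF hdc)
  rw [A.wproj_P_of_mem_filtration hF, A.mem_weightForms.1 hp] at H
  refine IsZigzag.congr A H fun j h1 _ => ?_
  rw [A.wproj_P hp j h1, neg_neg]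

/-- `Π_E` is homotopic to the identity through `P d_0⁻¹`, which respects the filtration. So `P d_0⁻¹
d X` lies in `F_{p+r}`, and the other term is `d` of a form in `F_p`; both are boundaries of the
required kind. -/
theorem sub_projE_mem_boundaries {r : ℕ} (hr : 1 ≤ r) {p : ℤ} {X : Forms E G}
    (hX : X ∈ cycles (d E G) A.filtration r p) :
    X - A.projE X ∈ boundaries (d E G) A.filtration r p := by
  obtain ⟨s, rfl⟩ : ∃ s, r = s + 1 := ⟨r - 1, by omega⟩
  have e : X - A.projE X = A.P (A.d0inv (d E G X)) + d E G (A.P (A.d0inv X)) := by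
    rw [projE_apply]
    abel
  have h1 : A.P (A.d0inv (d E G X)) ∈ A.filtration (p + (s + 1 : ℕ)) :=
    A.P_mem_filtration (A.d0inv_mem_filtration hX.2)
  have h2 : A.P (A.d0inv X) ∈ A.filtration p :=
    A.P_mem_filtration (A.d0inv_mem_filtration hX.1)
  rw [e]
  refine Submodule.add_mem_sup ⟨A.filtration_anti (by omega) h1, ?_⟩
    ⟨_, ⟨A.filtration_anti (by omega) h2, ?_⟩, rfl⟩
  · exact A.filtration_anti (by omega) (A.d_mem_filtration h1)
  · exact A.filtration_anti (by omega) (A.d_mem_filtration h2)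

theorem projE_mem_cycles {r : ℕ} {p : ℤ} {X : Forms E G}
    (hX : X ∈ cycles (d E G) A.filtration r p) :
    A.projE X ∈ cycles (d E G) A.filtration r p := by
  have h2 : A.P (A.d0inv X) ∈ A.filtration p :=
    A.P_mem_filtration (A.d0inv_mem_filtration hX.1)
  have h1 : A.P (A.d0inv (d E G X)) ∈ A.filtration (p + r) :=
    A.P_mem_filtration (A.d0inv_mem_filtration hX.2)
  rw [projE_apply]
  have h3 : d E G (A.P (A.d0inv X)) ∈ cycles (d E G) A.filtration r p := by
    refine mem_cycles.2 ⟨A.d_mem_filtration h2, ?_⟩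
    rw [d_d]
    exact Submodule.zero_mem _
  have h4 : A.P (A.d0inv (d E G X)) ∈ cycles (d E G) A.filtration r p :=
    mem_cycles.2 ⟨A.filtration_anti (by omega) h1, A.d_mem_filtration h1⟩
  exact Submodule.sub_mem _ (Submodule.sub_mem _ hX h3) h4

/-- Every class of `Z_r / B_r` has a representative that is the leading component of a Rumin
form. -/
theorem exists_rumin_lift {r : ℕ} (hr : 1 ≤ r) (p : ℤ) (ξ : A.ZB r p) :
    ∃ y ∈ A.ruminForms ⊓ A.filtration p, A.dc y ∈ A.filtration (p + r) ∧
      ∃ hx : A.wproj p y ∈ A.Z r p, ξ = cls _ _ _ hx := by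
  obtain ⟨⟨x, hx, z, H⟩, rfl⟩ := Submodule.Quotient.mk_surjective _ ξ
  set X := x - ∑ k ∈ Finset.Ico 1 r, z k with hXdef
  have hX : X ∈ cycles (d E G) A.filtration r p := A.zigzag_mem_cycles hx H
  have hXx : A.wproj p X = x := A.wproj_zigzag_zero hx H
  set Y := A.projE X with hY
  have hYc : Y ∈ cycles (d E G) A.filtration r p := A.projE_mem_cycles hX
  set y := A.projE0 Y with hy
  have hyE : y ∈ A.ruminForms := A.projE0_mem_ruminForms _
  have hyF : y ∈ A.filtration p := A.projE0_mem_filtration hYc.1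
  -- `Π_E X` is recovered from its Rumin part `y`, so `y` and `Π_E X` share the leading component,
  -- and the latter represents the same class as `X`.
  have hPy : A.P y = Y := A.P_projE0 (A.d0inv_projE X) (A.d0inv_d_projE X)
  have hwy : A.wproj p y = A.wproj p Y := by rw [← hPy, A.wproj_P_of_mem_filtration hyF]
  refine ⟨y, ⟨hyE, hyF⟩, ?_, hwy ▸ A.wproj_mem_Z hr hYc, cls_eq_iff.2 ?_⟩
  · rw [A.dc_of_mem_ruminForms hyE, hPy]
    exact A.projE0_mem_filtration hYc.2
  · rw [hwy, ← hXx, ← map_sub]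
    exact A.wproj_mem_B hr (A.sub_projE_mem_boundaries hr hX)

end AdaptedBasis
end SpectralSequenceOfWeights

end Carnot
end

theorem theorem4p7
    {E : Type*} [NormedAddCommGroup E] [NormedSpace ℝ E] [FiniteDimensional ℝ E]
    {G : Type*} [TopologicalSpace G] [ChartedSpace E G] [Group G]
    [LieGroup 𝓘(ℝ, E) ∞ G] [SimplyConnectedSpace G]
    (S : Carnot.Stratification E G) {n : ℕ} (A : Carnot.AdaptedBasis S n) :
    -- `Π_{E_0}` takes values in `E_0`, `d_c` maps `E_0^h` to `E_0^{h+1}`, and `d_0⁻¹ (d - d_0)` is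
    -- nilpotent
    (∀ α, A.projE0 α ∈ A.ruminForms) ∧
    (∀ h, ∀ α ∈ A.ruminForms ⊓ Carnot.Forms.degree h,
      A.dc α ∈ A.ruminForms ⊓ Carnot.Forms.degree (h + 1)) ∧
    A.nilOp ^ (A.homDim + 1) = 0 ∧
    -- `d_c = Π_{E_0} ∑_{r ≥ 1} D_r` on `E_0`, the `r`-th term being the part that raises the weight
    -- by `r`
    (∀ N, A.homDim ≤ N → ∀ α ∈ A.ruminForms,
      A.dc α = A.projE0 (∑ r ∈ Finset.Icc 1 N, A.diffPart r α)) ∧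
    (∀ r : ℕ, 1 ≤ r → ∀ p : ℤ, ∀ α ∈ A.ruminForms ⊓ A.weightForms p,
      A.wproj (p + r) (A.dc α) = A.projE0 (A.diffPart r α)) ∧
    -- the spectral sequence: for `r ≥ 1`, `E_r ≅ Z_r / B_r` by `[x] ↦ [(x)_p]`, and, with
    -- `∂_r` the differential of the `r`-th page read in `Z_r / B_r`,
    (∀ r : ℕ, 1 ≤ r → ∃ ψ : ∀ p : ℤ, A.specPage r p ≃ₗ[ℝ] A.ZB r p,
      (∀ (p : ℤ) (x : Carnot.Forms E G)
        (hx : x ∈ Carnot.cycles (Carnot.d E G) A.filtration r p),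
        ∃ hx' : A.wproj p x ∈ A.Z r p,
          ψ p (Carnot.cls _ _ x hx) = Carnot.cls _ _ (A.wproj p x) hx') ∧
      -- `∂_r [x] = [d_r x - ∑ d_i z_{p+r-i}]`
      (∀ (p : ℤ) (x : Carnot.Forms E G) (z : ℕ → Carnot.Forms E G),
        x ∈ A.weightForms p → A.IsZigzag r p x z →
        ∃ (hx : x ∈ A.Z r p)
          (hy : A.dW r x - ∑ i ∈ Finset.Ico 1 r, A.dW i (z (r - i)) ∈ A.Z r (p + r)),
          A.partialD r ψ p (Carnot.cls _ _ x hx) = Carnot.cls _ _ _ hy) ∧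
      -- if the `z_{p+j}` are orthogonal to `ker d_0`, they are given by `d_0⁻¹` and the `d_i`, and
      -- `∂_r [x] = [D_r x]`
      (∀ (p : ℤ) (x : Carnot.Forms E G) (z : ℕ → Carnot.Forms E G),
        x ∈ A.weightForms p → A.IsZigzag r p x z →
        (∀ j, 1 ≤ j → j < r → ∀ κ, A.dW 0 κ = 0 → A.Ortho (z j) κ) →
        (∀ j, 1 ≤ j → j < r → z j = A.zOp j x) ∧
        ∃ (hx : x ∈ A.Z r p) (hy : A.diffPart r x ∈ A.Z r (p + r)),
          A.partialD r ψ p (Carnot.cls _ _ x hx) = Carnot.cls _ _ _ hy) ∧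
      -- this is the case for Rumin forms of weight `p` whose Rumin differential has weight at
      -- least `p + r`
      (∀ (p : ℤ), ∀ α ∈ A.ruminForms ⊓ A.weightForms p, A.dc α ∈ A.filtration (p + r) →
        A.IsZigzag r p α (fun j => A.zOp j α) ∧
        (∀ j, 1 ≤ j → j < r → ∀ κ, A.dW 0 κ = 0 → A.Ortho (A.zOp j α) κ)) ∧
      -- all of `∂_r` is induced by `d_c`
      (∀ (p : ℤ), ∀ y ∈ A.ruminForms ⊓ A.filtration p, A.dc y ∈ A.filtration (p + r) →
        ∃ (hx : A.wproj p y ∈ A.Z r p) (hy : A.wproj (p + r) (A.dc y) ∈ A.Z r (p + r)),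
          A.partialD r ψ p (Carnot.cls _ _ _ hx) = Carnot.cls _ _ _ hy) ∧
      (∀ (p : ℤ) (ξ : A.ZB r p), ∃ y ∈ A.ruminForms ⊓ A.filtration p,
        A.dc y ∈ A.filtration (p + r) ∧
        ∃ hx : A.wproj p y ∈ A.Z r p, ξ = Carnot.cls _ _ _ hx)) := by
  refine ⟨A.projE0_mem_ruminForms, fun h α hα => ⟨A.dc_mem_ruminForms α, ?_⟩,
    A.nilOp_pow_eq_zero, fun N hN α hα => A.dc_eq_sum hN hα,
    fun r hr p α hα => A.wproj_dc hα.1 hα.2 r hr, fun r hr => ⟨A.pageEquiv hr, ?_⟩⟩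
  · have := A.dc_mem_intDegree (Carnot.Forms.mem_degree.1 hα.2)
    exact Carnot.Forms.mem_degree.2 (by exact_mod_cast this)
  refine ⟨fun p x hx => ⟨A.wproj_mem_Z hr hx, A.pageMap_cls hr p hx⟩, fun p x z hx H => ?_,
    fun p x z hx H ho => ?_, fun p α hα hdc => ?_, fun p y hy hdc => ?_, A.exists_rumin_lift hr⟩
  · exact A.exists_partialD_eq hr (A.zigzag_mem_cycles hx H) (A.wproj_zigzag_zero hx H)
      (A.wproj_d_zigzag hr hx H)
  · have hz := A.eq_zOp_of_ortho H ho
    refine ⟨hz, A.exists_partialD_eq hr (A.zigzag_mem_cycles hx H) (A.wproj_zigzag_zero hx H) ?_⟩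
    rw [A.wproj_d_zigzag hr hx H, A.diffPart_apply]
    congr 1
    refine Finset.sum_congr rfl fun i hi => ?_
    rw [Finset.mem_Ico] at hi
    rw [hz (r - i) (by omega) (by omega)]
  · refine ⟨A.isZigzag_zOp hr hα.1 hα.2 hdc, fun j h1 _ κ hκ => ?_⟩
    rw [A.zOp_apply h1]
    exact A.ortho_d0inv _ hκ
  -- The lift is `P y`; by `P_dc` its differential is `P (d_c y)`, and `P` preserves both leading
  -- components.
  · refine A.exists_partialD_eq hr (A.P_mem_cycles hy.1 hy.2 hdc)
      (A.wproj_P_of_mem_filtration hy.2) ?_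
    rw [← A.P_dc hy.1, A.wproj_P_of_mem_filtration hdc]
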